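/- **Theorem (Tararin).** Let $G$ be a countable group, and let $LO(G)$ be the set of left orders on $G$, i.e. of strict total orders $<$ on $G$ such that $f<g$ implies $hf<hg$. A *rational group* is an abelian group that embeds into $(\mathbb Q,+)$. A *rational series* of $G$ of length $n+1$ is a sequence of subgroups $$G=G_0\rhd G_1\rhd\cdots\rhd G_n\rhd G_{n+1}=\{e\}$$ in which each $G_{i+1}$ is a proper normal subgroup of $G_i$ and each $G_i/G_{i+1}$ is a rational group; the length $n+1\ge 0$ is part of the series, and it is $0$ (that is, $n=-1$) exactly when $G$ is trivial. A subgroup $H\le G$ is *convex* for a left order $<$ if $h_1<g<h_2$ with $h_1,h_2\in H$ and $g\in G$ implies $g\in H$. A group is *bi-orderable* if it has a left order that is also invariant under right multiplication. **(I)** Assume that $LO(G)$ is nonempty and finite. Then: 1. $G$ has exactly one rational series $G=G_0\rhd\cdots\rhd G_{n+1}=\{e\}$; each $G_i$ is a characteristic subgroup of $G$, in particular normal in $G$. 2. There are elements $s_i\in G_i\setminus G_{i+1}$ $(0\le i\le n)$ such that for every $\epsilon:\{0,\dots,n\}\to\{\pm1\}$ there is exactly one left order $\lambda_\epsilon$ on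 $G$ for which $s_i^{\epsilon(i)}$ is positive (i.e. $e<s_i^{\epsilon(i)}$) for all $i$. Moreover $LO(G)=\{\lambda_\epsilon\mid \epsilon\in\{\pm1\}^{\{0,\dots,n\}}\}$, and $|LO(G)|=2^{n+1}$. 3. For every $\lambda\in LO(G)$, the strictly decreasing sequence $G=G_0>G_1>\cdots>G_{n+1}=\{e\}$ consists of exactly all the $\lambda$-convex subgroups of $G$ (it is the maximal convex sequence of $\lambda$). 4. For $0\le i\le n-1$, the group $G_i/G_{i+2}$ is not bi-orderable. **(II)** Conversely, if $G$ has a rational series $G=G_0\rhd\cdots\rhd G_{n+1}=\{e\}$ such that, for $0\le i\le n-1$, $G_{i+2}$ is normal in $G_i$ and $G_i/G_{i+2}$ is not bi-orderable, then $|LO(G)|=2^{n+1}$. -/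

import Mathlib

namespace Tararin

/-- A left order on `G`: a strict total order `<` such that `f < g` implies `h * f < h * g`.
The type `LeftOrder G` is the set `LO(G)` of all left orders. -/
@[ext]
structure LeftOrder (G : Type*) [Group G] where
  lt : G → G → Prop
  irrefl : ∀ g, ¬ lt g g
  trans : ∀ f g h, lt f g → lt g h → lt f h
  total : ∀ f g, lt f g ∨ f = g ∨ lt g f
  mul_left : ∀ f g h, lt f g → lt (h * f) (h * g)

/-- `g` is positive for the order. -/
def LeftOrder.IsPositive {G : Type*} [Group G] (r : LeftOrder G) (g : G) : Prop :=
  r.lt 1 g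

/-- `H` is convex: elements lying strictly between two elements of `H` belong to `H`. -/
def LeftOrder.IsConvex {G : Type*} [Group G] (r : LeftOrder G) (H : Subgroup G) : Prop :=
  ∀ h₁ ∈ H, ∀ h₂ ∈ H, ∀ g : G, r.lt h₁ g → r.lt g h₂ → g ∈ H

/-- `S 0 > S 1 > ... > S m` is the sequence of all convex subgroups of the order, from `G`
down to the trivial subgroup. -/
def LeftOrder.IsMaximalConvexSequence {G : Type*} [Group G] (r : LeftOrder G) {m : ℕ}
    (S : Fin (m + 1) → Subgroup G) : Prop :=
  S 0 = ⊤ ∧ S (Fin.last m) = ⊥ ∧ StrictAnti S ∧ ∀ H : Subgroup G, r.IsConvex H ↔ ∃ i, S i = H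

/-- A group is bi-orderable if it carries a left order that is also invariant under
right multiplication. -/
def IsBiOrderable (G : Type*) [Group G] : Prop :=
  ∃ r : LeftOrder G, ∀ f g h, r.lt f g → r.lt (f * h) (g * h)

/-- A rational group: one that embeds into the additive group `ℚ` (in particular, it is
abelian). -/
def IsRationalGroup (G : Type*) [Group G] : Prop :=
  ∃ f : G →* Multiplicative ℚ, Function.Injective f

/-- A rational series `G = G_0 ▷ G_1 ▷ ... ▷ G_length = {e}`: every term is a proper normal
subgroup of the preceding one, with rational quotient. Length zero occurs only for the trivial
group. -/
structure RationalSeries (G : Type*) [Group G] where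
  length : ℕ
  term : Fin (length + 1) → Subgroup G
  first : term 0 = ⊤
  last : term (Fin.last length) = ⊥
  strict : ∀ i : Fin length, term i.succ < term i.castSucc
  rational : ∀ i : Fin length, ∃ _ : ((term i.succ).subgroupOf (term i.castSucc)).Normal,
    IsRationalGroup (term i.castSucc ⧸ (term i.succ).subgroupOf (term i.castSucc))

/-- For all `i` with `i + 2 ≤ length`, the term `G_{i+2}` is normal in `G_i`, and the group
`G_i / G_{i+2}` is not bi-orderable. -/
def RationalSeries.NonBiOrderableQuotients {G : Type*} [Group G] (S : RationalSeries G) : Prop :=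
  ∀ i j : Fin (S.length + 1), (j : ℕ) = (i : ℕ) + 2 →
    ∃ _ : ((S.term j).subgroupOf (S.term i)).Normal,
      ¬ IsBiOrderable (S.term i ⧸ (S.term j).subgroupOf (S.term i))

end Tararin

/-! Suppose `K` is convex in `H` and `H / K` lies in `ℚ`. Since rationals are commensurable, one
sign fixes the order on `H \ K`. So if all left orders have the terms of one rational series as
convex subgroups, they are exactly the lexicographic orders, one for each choice of signs.

Part (II) supplies this convexity. If `G_i / G_{i+2}` is not bi-orderable, some element of `G_i`
reverses a sign on `G_{i+1} / G_{i+2}` by conjugation. An element acting negatively dominates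
`G_{i+1}`, so `G_{i+1}` is convex in `G_i` (`ConvexIn.of_conj_neg`), by induction from the bottom.

For part (I), start from one order. Reversing it on each convex subgroup shows that there are
finitely many of them. Conjugation by `m`-th powers, for a common `m`, preserves every order, so the
jumps between convex subgroups are Archimedean and embed in `ℝ` by Hölder's theorem. Modifying the
order along homomorphisms shows that any two homomorphisms from a convex subgroup to `ℚ` are
proportional (`ConvexIn.hom_dependent`), hence jumps are rational and conjugation acts on them by
scalars. If the scalars on `G_{i+1} / G_{i+2}` were all `1`, then `G_i / G_{i+2}` would be abelian
with two independent homomorphisms to `ℚ`. If they were positive but not all `1`, an affine action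
on `ℚ` would give an order not preserved by an `m`-th power. So `G_i / G_{i+2}` is not bi-orderable,
and the argument for (II) then covers every left order. -/

namespace Tararin

variable {G : Type*} [Group G]

/-! ### Positive cones and relative convexity -/

namespace LeftOrder

theorem lt_iff (r : LeftOrder G) (a b : G) : r.lt a b ↔ r.IsPositive (a⁻¹ * b) := by
  constructor
  · intro h
    have := r.mul_left _ _ a⁻¹ h
    simpa [IsPositive] using this
  · intro h
    have := r.mul_left _ _ a h
    simpa [IsPositive] using this

theorem ext_isPositive {r r' : LeftOrder G} (h : ∀ x, r.IsPositive x ↔ r'.IsPositive x) :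
    r = r' := by
  ext a b
  rw [lt_iff, lt_iff, h]

theorem not_isPositive_one (r : LeftOrder G) : ¬ r.IsPositive 1 := r.irrefl 1

theorem isPositive_mul (r : LeftOrder G) {x y : G} (hx : r.IsPositive x) (hy : r.IsPositive y) :
    r.IsPositive (x * y) := by
  have := r.mul_left _ _ x hy
  rw [mul_one] at this
  exact r.trans _ _ _ hx this

theorem isPositive_or (r : LeftOrder G) (x : G) :
    x = 1 ∨ r.IsPositive x ∨ r.IsPositive x⁻¹ := by
  rcases r.total 1 x with h | h | h
  · exact Or.inr (Or.inl h)
  · exact Or.inl h.symm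
  · rw [lt_iff, mul_one] at h
    exact Or.inr (Or.inr h)

theorem not_isPositive_inv (r : LeftOrder G) {x : G} (hx : r.IsPositive x) :
    ¬ r.IsPositive x⁻¹ := fun h =>
  r.not_isPositive_one (by simpa using r.isPositive_mul hx h)

theorem isPositive_inv_of_not (r : LeftOrder G) {x : G} (h1 : x ≠ 1) (hx : ¬ r.IsPositive x) :
    r.IsPositive x⁻¹ :=
  ((r.isPositive_or x).resolve_left h1).resolve_left hx

theorem isPositive_pow (r : LeftOrder G) {x : G} (hx : r.IsPositive x) :
    ∀ {n : ℕ}, n ≠ 0 → r.IsPositive (x ^ n)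
  | 0, h => absurd rfl h
  | 1, _ => by simpa using hx
  | n + 2, _ => by
    rw [pow_succ]
    exact r.isPositive_mul (isPositive_pow r hx (Nat.succ_ne_zero n)) hx

theorem isPositive_of_pow (r : LeftOrder G) {x : G} {n : ℕ} (hx : r.IsPositive (x ^ n)) :
    r.IsPositive x := by
  rcases r.isPositive_or x with rfl | h | h
  · simpa using hx
  · exact h
  · rcases eq_or_ne n 0 with rfl | hn
    · exact absurd (by simpa using hx) r.not_isPositive_one
    · have := r.isPositive_pow h hn
      rw [inv_pow] at this
      exact absurd this (r.not_isPositive_inv hx)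

/-- The left order with a given positive cone. -/
def ofCone (P : G → Prop) (h1 : ¬ P 1) (hmul : ∀ x y, P x → P y → P (x * y))
    (htot : ∀ x, x ≠ 1 → P x ∨ P x⁻¹) : LeftOrder G where
  lt a b := P (a⁻¹ * b)
  irrefl g := by simpa using h1
  trans f g h hfg hgh := by simpa [mul_assoc] using hmul _ _ hfg hgh
  total f g := by
    by_cases h : f = g
    · exact Or.inr (Or.inl h)
    · rcases htot (f⁻¹ * g) (fun h' => h (inv_mul_eq_one.mp h')) with h' | h'
      · exact Or.inl h'
      · exact Or.inr (Or.inr (by simpa using h'))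
  mul_left f g h hfg := by simpa [mul_assoc] using hfg

@[simp]
theorem ofCone_isPositive (P : G → Prop) (h1 : ¬ P 1) (hmul : ∀ x y, P x → P y → P (x * y))
    (htot : ∀ x, x ≠ 1 → P x ∨ P x⁻¹) (x : G) :
    (ofCone P h1 hmul htot).IsPositive x ↔ P x := by
  simp [IsPositive, ofCone]

/-- `K` is convex relative to `H`: the sign of an element of `H` outside `K` is not changed by
multiplication with elements of `K`. -/
def ConvexIn (r : LeftOrder G) (K H : Subgroup G) : Prop :=
  ∀ x ∈ H, x ∉ K → r.IsPositive x → ∀ h ∈ K, r.IsPositive (x * h)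

theorem isConvex_iff (r : LeftOrder G) (K : Subgroup G) : r.IsConvex K ↔ r.ConvexIn K ⊤ := by
  constructor
  · intro hK x _ hxK hx h hh
    by_contra hn
    have hne : x * h ≠ 1 := fun h' => hxK (by rw [mul_eq_one_iff_eq_inv.mp h']; exact K.inv_mem hh)
    have := r.isPositive_inv_of_not hne hn
    apply hxK
    have h2 := hK h hh 1 K.one_mem x⁻¹ (by rwa [lt_iff, ← mul_inv_rev]) (by
      rw [lt_iff]; simpa using hx)
    simpa using h2
  · intro hK h₁ hh₁ h₂ hh₂ g h1 h2
    by_contra hg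
    rw [lt_iff] at h1 h2
    have hg' : g⁻¹ * h₂ ∉ K := by
      rw [K.mul_mem_cancel_right hh₂]
      simpa using hg
    have := hK _ trivial hg' h2 (h₂⁻¹ * h₁) (K.mul_mem (K.inv_mem hh₂) hh₁)
    refine r.not_isPositive_inv h1 ?_
    simpa [mul_assoc] using this

theorem ConvexIn.mono {r : LeftOrder G} {K H H' : Subgroup G} (h : r.ConvexIn K H)
    (hle : H' ≤ H) : r.ConvexIn K H' := fun x hx => h x (hle hx)

theorem ConvexIn.trans {r : LeftOrder G} {L K H : Subgroup G} (h1 : r.ConvexIn L K)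
    (h2 : r.ConvexIn K H) (hLK : L ≤ K) : r.ConvexIn L H := by
  intro x hx hxL hP h hh
  by_cases hxK : x ∈ K
  · exact h1 x hxK hxL hP h hh
  · exact h2 x hx hxK hP h (hLK hh)

theorem ConvexIn.left {r : LeftOrder G} {K H : Subgroup G} (hc : r.ConvexIn K H) (hKH : K ≤ H)
    {x : G} (hx : x ∈ H) (hxK : x ∉ K) (hP : r.IsPositive x) {h : G} (hh : h ∈ K) :
    r.IsPositive (h * x) := by
  by_contra hn
  have hnK : h * x ∉ K := by rwa [K.mul_mem_cancel_left hh]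
  have h1 := r.isPositive_inv_of_not (fun h' => hnK (by rw [h']; exact K.one_mem)) hn
  have h2 := hc _ (H.inv_mem (H.mul_mem (hKH hh) hx)) (by rwa [K.inv_mem_iff]) h1 h hh
  exact r.not_isPositive_inv hP (by simpa using h2)

theorem ConvexIn.le_total {r : LeftOrder G} {K H : Subgroup G} (hK : r.ConvexIn K ⊤)
    (hH : r.ConvexIn H ⊤) : K ≤ H ∨ H ≤ K := by
  by_contra! hcon
  obtain ⟨⟨x, hxK, hxH⟩, y, hyH, hyK⟩ :=
    And.imp SetLike.not_le_iff_exists.mp SetLike.not_le_iff_exists.mp hcon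
  wlog hx : r.IsPositive x generalizing x
  · exact this x⁻¹ (K.inv_mem hxK) (by simpa using hxH)
      (r.isPositive_inv_of_not (fun h => hxH (h ▸ H.one_mem)) hx)
  wlog hy : r.IsPositive y generalizing y
  · exact this y⁻¹ (H.inv_mem hyH) (by simpa using hyK)
      (r.isPositive_inv_of_not (fun h => hyK (h ▸ K.one_mem)) hy)
  have h1 := hH.left le_top trivial hxH hx (H.inv_mem hyH)
  have h2 := hK.left le_top trivial hyK hy (K.inv_mem hxK)
  exact r.not_isPositive_inv h1 (by simpa using h2)

end LeftOrder

/-! ### Rational quotients as kernels of maps to `ℚ` -/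

/-- `φ` restricts to a homomorphism from `H` to the additive group of rationals. -/
def IsHomOn (H : Subgroup G) (φ : G → ℚ) : Prop :=
  ∀ x ∈ H, ∀ y ∈ H, φ (x * y) = φ x + φ y

/-- `φ` restricts to a homomorphism from `H` to `ℚ` with kernel `K`. -/
structure IsQuot (K H : Subgroup G) (φ : G → ℚ) : Prop where
  le : K ≤ H
  hom : IsHomOn H φ
  ker : ∀ x ∈ H, φ x = 0 ↔ x ∈ K

namespace IsHomOn

variable {H : Subgroup G} {φ : G → ℚ}

theorem map_one (h : IsHomOn H φ) : φ 1 = 0 := by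
  have := h 1 H.one_mem 1 H.one_mem
  rw [mul_one] at this
  linarith

theorem map_inv (h : IsHomOn H φ) {x : G} (hx : x ∈ H) : φ x⁻¹ = - φ x := by
  have := h x hx x⁻¹ (H.inv_mem hx)
  rw [mul_inv_cancel, h.map_one] at this
  linarith

theorem map_pow (h : IsHomOn H φ) {x : G} (hx : x ∈ H) (n : ℕ) : φ (x ^ n) = n * φ x := by
  induction n with
  | zero => simp [h.map_one]
  | succ n ih =>
    rw [pow_succ, h _ (H.pow_mem hx n) _ hx, ih]
    push_cast
    ring

theorem map_zpow (h : IsHomOn H φ) {x : G} (hx : x ∈ H) (n : ℤ) : φ (x ^ n) = n * φ x := by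
  rcases n with n | n
  · simpa using h.map_pow hx n
  · rw [zpow_negSucc, h.map_inv (H.pow_mem hx _), h.map_pow hx]
    push_cast
    ring

theorem map_conj (h : IsHomOn H φ) {x y : G} (hx : x ∈ H) (hy : y ∈ H) :
    φ (x * y * x⁻¹) = φ y := by
  rw [h _ (H.mul_mem hx hy) _ (H.inv_mem hx), h _ hx _ hy, h.map_inv hx]
  ring

end IsHomOn

theorem IsQuot.conj_mem {K H : Subgroup G} {φ : G → ℚ} (h : IsQuot K H φ) {x y : G}
    (hx : x ∈ H) (hy : y ∈ K) : x * y * x⁻¹ ∈ K := by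
  have hy' := h.le hy
  rw [← h.ker _ (H.mul_mem (H.mul_mem hx hy') (H.inv_mem hx)), h.hom.map_conj hx hy', h.ker _ hy']
  exact hy

theorem IsQuot.normal {K H : Subgroup G} {φ : G → ℚ} (h : IsQuot K H φ) :
    (K.subgroupOf H).Normal := by
  constructor
  intro n hn g
  rw [Subgroup.mem_subgroupOf] at hn ⊢
  exact h.conj_mem g.2 hn

theorem IsQuot.isRationalGroup {K H : Subgroup G} {φ : G → ℚ} (h : IsQuot K H φ)
    [hn : (K.subgroupOf H).Normal] : IsRationalGroup (H ⧸ K.subgroupOf H) := by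
  let f : H →* Multiplicative ℚ :=
    MonoidHom.mk' (fun x => Multiplicative.ofAdd (φ x)) (fun x y => by
      simp [h.hom _ x.2 _ y.2, ofAdd_add])
  have hf : ∀ x : H, f x = 1 ↔ x ∈ K.subgroupOf H := fun x => by
    rw [Subgroup.mem_subgroupOf, ← h.ker _ x.2]
    simp [f]
  refine ⟨QuotientGroup.lift (K.subgroupOf H) f (fun x hx => MonoidHom.mem_ker.mpr ((hf x).mpr hx)), ?_⟩
  rw [injective_iff_map_eq_one]
  intro a
  induction a using QuotientGroup.induction_on with
  | H x =>
    intro hx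
    exact (QuotientGroup.eq_one_iff x).mpr ((hf x).mp hx)

theorem exists_isQuot {K H : Subgroup G} (hle : K ≤ H)
    (h : ∃ _ : (K.subgroupOf H).Normal, IsRationalGroup (H ⧸ K.subgroupOf H)) :
    ∃ φ, IsQuot K H φ := by
  classical
  obtain ⟨hn, f, hf⟩ := h
  refine ⟨fun x => if hx : x ∈ H then (f (QuotientGroup.mk ⟨x, hx⟩)).toAdd else 0, hle, ?_, ?_⟩
  · intro x hx y hy
    simp only [hx, hy, H.mul_mem hx hy, dif_pos]
    rw [← toAdd_mul, ← _root_.map_mul, ← QuotientGroup.mk_mul]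
    rfl
  · intro x hx
    simp only [hx, dif_pos]
    rw [toAdd_eq_zero, map_eq_one_iff f hf, QuotientGroup.eq_one_iff, Subgroup.mem_subgroupOf]

/-- Signs of elements outside a convex kernel are governed by the homomorphism. -/
theorem LeftOrder.ConvexIn.isPositive_of_mul_pos {r : LeftOrder G} {K H : Subgroup G} {φ : G → ℚ}
    (hc : r.ConvexIn K H) (hφ : IsQuot K H φ) {x y : G} (hx : x ∈ H) (hy : y ∈ H)
    (hxy : 0 < φ x * φ y) (hP : r.IsPositive x) : r.IsPositive y := by
  have hx0 : φ x ≠ 0 := fun h => by simp [h] at hxy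
  have hy0 : φ y ≠ 0 := fun h => by simp [h] at hxy
  have hq : 0 < φ y / φ x := by
    rw [← mul_div_mul_right _ _ hx0, mul_comm (φ y)]
    exact div_pos hxy (mul_self_pos.mpr hx0)
  -- Commensurability: `u / v` is `φ y / φ x` in lowest terms, so `y ^ v` and `x ^ u` agree modulo
  -- `K`.
  obtain ⟨u, v, hu, hv, huv⟩ : ∃ u v : ℕ, u ≠ 0 ∧ v ≠ 0 ∧ (v : ℚ) * φ y = u * φ x := by
    have hnum : 0 < (φ y / φ x).num := Rat.num_pos.mpr hq
    refine ⟨(φ y / φ x).num.toNat, (φ y / φ x).den, by omega, (φ y / φ x).den_nz, ?_⟩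
    have h1 : (((φ y / φ x).num.toNat : ℤ) : ℚ) = (φ y / φ x).num := by
      rw [Int.toNat_of_nonneg hnum.le]
    have h2 := Rat.num_div_den (φ y / φ x)
    have h3 : ((φ y / φ x).den : ℚ) ≠ 0 := by exact_mod_cast (φ y / φ x).den_nz
    rw [Int.cast_natCast] at h1
    rw [h1]
    field_simp at h2
    linarith
  apply r.isPositive_of_pow (n := v)
  have hxu := H.pow_mem hx u
  have hK : (x ^ u)⁻¹ * y ^ v ∈ K := by
    rw [← hφ.ker _ (H.mul_mem (H.inv_mem hxu) (H.pow_mem hy v)),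
      hφ.hom _ (H.inv_mem hxu) _ (H.pow_mem hy v), hφ.hom.map_inv hxu, hφ.hom.map_pow hx,
      hφ.hom.map_pow hy]
    linarith
  have := hc _ hxu (by rw [← hφ.ker _ hxu, hφ.hom.map_pow hx]; simp [hu, hx0])
    (r.isPositive_pow hP hu) _ hK
  simpa using this

/-! ### Lexicographic orders and their parametrization by signs -/

namespace RationalSeries

theorem strictAnti (S : RationalSeries G) : StrictAnti S.term :=
  Fin.strictAnti_iff_succ_lt.mpr S.strict

theorem exists_mem_notMem (S : RationalSeries G) {x : G} (hx : x ≠ 1) :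
    ∃ i : Fin S.length, x ∈ S.term i.castSucc ∧ x ∉ S.term i.succ := by
  by_contra! h
  have : ∀ i, x ∈ S.term i := fun i => by
    induction i using Fin.induction with
    | zero => rw [S.first]; trivial
    | succ i ih => exact h i ih
  have h2 := this (Fin.last _)
  rw [S.last, Subgroup.mem_bot] at h2
  exact hx h2

theorem exists_isQuot (S : RationalSeries G) :
    ∃ φ : Fin S.length → G → ℚ, ∀ i, IsQuot (S.term i.succ) (S.term i.castSucc) (φ i) := by
  choose φ hφ using fun i => Tararin.exists_isQuot (S.strict i).le (S.rational i)
  exact ⟨φ, hφ⟩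

/-- The lexicographic left orders attached to a rational series. -/
theorem exists_lex (S : RationalSeries G) {φ : Fin S.length → G → ℚ}
    (hφ : ∀ i, IsQuot (S.term i.succ) (S.term i.castSucc) (φ i)) (ε : Fin S.length → ℤˣ) :
    ∃ r : LeftOrder G, (∀ k, r.ConvexIn (S.term k) ⊤) ∧
      ∀ i, ∀ x ∈ S.term i.castSucc, 0 < ((ε i : ℤ) : ℚ) * φ i x → r.IsPositive x := by
  have key : ∀ i j : Fin S.length, i < j → S.term j.castSucc ≤ S.term i.succ := fun i j hij =>
    S.strictAnti.antitone (Fin.succ_le_castSucc_iff.mpr hij)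
  -- The inequality forces `φ i x ≠ 0`, so `i` can only be the layer in which `x` leaves the series.
  let P : G → Prop := fun x => ∃ i, x ∈ S.term i.castSucc ∧ 0 < ((ε i : ℤ) : ℚ) * φ i x
  have h1 : ¬ P 1 := by
    rintro ⟨i, hi, h⟩
    rw [(hφ i).hom.map_one] at h
    simp at h
  have hmul : ∀ x y, P x → P y → P (x * y) := by
    rintro x y ⟨i, hxi, hx⟩ ⟨j, hyj, hy⟩
    rcases lt_trichotomy i j with h | rfl | h
    · have hy' := key i j h hyj
      refine ⟨i, Subgroup.mul_mem _ hxi ((hφ i).le hy'), ?_⟩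
      rwa [(hφ i).hom _ hxi _ ((hφ i).le hy'), ((hφ i).ker y ((hφ i).le hy')).mpr hy', add_zero]
    · refine ⟨i, Subgroup.mul_mem _ hxi hyj, ?_⟩
      rw [(hφ i).hom _ hxi _ hyj, mul_add]
      exact add_pos hx hy
    · have hx' := key j i h hxi
      refine ⟨j, Subgroup.mul_mem _ ((hφ j).le hx') hyj, ?_⟩
      rwa [(hφ j).hom _ ((hφ j).le hx') _ hyj, ((hφ j).ker x ((hφ j).le hx')).mpr hx', zero_add]
  have htot : ∀ x, x ≠ 1 → P x ∨ P x⁻¹ := by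
    intro x hx
    obtain ⟨i, hi, hi'⟩ := S.exists_mem_notMem hx
    rw [← (hφ i).ker x hi] at hi'
    have hne : ((ε i : ℤ) : ℚ) * φ i x ≠ 0 := mul_ne_zero (by simp) hi'
    rcases hne.lt_or_gt with h | h
    · refine Or.inr ⟨i, Subgroup.inv_mem _ hi, ?_⟩
      rw [(hφ i).hom.map_inv hi]
      linarith
    · exact Or.inl ⟨i, hi, h⟩
  refine ⟨LeftOrder.ofCone P h1 hmul htot, fun k x _ hxk hPx h hh => ?_, fun i x hx hpos => ?_⟩
  · rw [LeftOrder.ofCone_isPositive] at hPx ⊢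
    obtain ⟨i, hxi, hx⟩ := hPx
    have hik : i.succ ≤ k := by
      by_contra hlt
      exact hxk (S.strictAnti.antitone (Fin.le_castSucc_iff.mpr (not_le.mp hlt)) hxi)
    have hh' := S.strictAnti.antitone hik hh
    refine ⟨i, Subgroup.mul_mem _ hxi ((hφ i).le hh'), ?_⟩
    rwa [(hφ i).hom _ hxi _ ((hφ i).le hh'), ((hφ i).ker h ((hφ i).le hh')).mpr hh', add_zero]
  · rw [LeftOrder.ofCone_isPositive]
    exact ⟨i, hx, hpos⟩

/-- Each nontrivial `x` leaves the series at one layer `i`, where its sign is that of `y i` times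
the sign of `φ i x * φ i (y i)`. -/
theorem order_ext (S : RationalSeries G) {r r' : LeftOrder G}
    (hr : ∀ i : Fin S.length, r.ConvexIn (S.term i.succ) (S.term i.castSucc))
    (hr' : ∀ i : Fin S.length, r'.ConvexIn (S.term i.succ) (S.term i.castSucc))
    (y : Fin S.length → G) (hy : ∀ i, y i ∈ S.term i.castSucc) (hy' : ∀ i, y i ∉ S.term i.succ)
    (hP : ∀ i, r.IsPositive (y i)) (hP' : ∀ i, r'.IsPositive (y i)) : r = r' := by
  obtain ⟨φ, hφ⟩ := S.exists_isQuot
  have key : ∀ r r' : LeftOrder G,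
      (∀ i : Fin S.length, r.ConvexIn (S.term i.succ) (S.term i.castSucc)) →
      (∀ i : Fin S.length, r'.ConvexIn (S.term i.succ) (S.term i.castSucc)) →
      (∀ i, r.IsPositive (y i)) → (∀ i, r'.IsPositive (y i)) →
      ∀ x, r.IsPositive x → r'.IsPositive x := by
    intro r r' hr hr' hP hP' x hx
    obtain ⟨i, hi, hi'⟩ := S.exists_mem_notMem (fun h : x = 1 => r.not_isPositive_one (h ▸ hx))
    have hx0 : φ i x ≠ 0 := fun h => hi' (((hφ i).ker x hi).mp h)
    have hy0 : φ i (y i) ≠ 0 := fun h => hy' i (((hφ i).ker _ (hy i)).mp h)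
    rcases (mul_ne_zero hy0 hx0).lt_or_gt with h | h
    · refine absurd ((hr i).isPositive_of_mul_pos (hφ i) (hy i) (Subgroup.inv_mem _ hi) ?_ (hP i))
        (r.not_isPositive_inv hx)
      rw [(hφ i).hom.map_inv hi]
      linarith
    · exact (hr' i).isPositive_of_mul_pos (hφ i) (hy i) hi h (hP' i)
  exact LeftOrder.ext_isPositive fun x =>
    ⟨key r r' hr hr' hP hP' x, key r' r hr' hr hP' hP x⟩

theorem exists_parametrization (S : RationalSeries G)
    (hS : ∀ (r : LeftOrder G) (i : Fin S.length),
      r.ConvexIn (S.term i.succ) (S.term i.castSucc)) :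
    (∃ s : Fin S.length → G,
      (∀ i, s i ∈ S.term i.castSucc ∧ s i ∉ S.term i.succ) ∧
      ∃ Λ : (Fin S.length → ℤˣ) → LeftOrder G,
        (∀ ε, (∀ i, (Λ ε).IsPositive (s i ^ ((ε i : ℤˣ) : ℤ))) ∧
          ∀ r : LeftOrder G, (∀ i, r.IsPositive (s i ^ ((ε i : ℤˣ) : ℤ))) → r = Λ ε) ∧
        Set.range Λ = Set.univ) ∧
    Nat.card (LeftOrder G) = 2 ^ S.length := by
  obtain ⟨φ, hφ⟩ := S.exists_isQuot
  have hs : ∀ i : Fin S.length, ∃ s ∈ S.term i.castSucc, 0 < φ i s := by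
    intro i
    obtain ⟨s, hs, hs'⟩ := SetLike.exists_of_lt (S.strict i)
    rw [← (hφ i).ker s hs] at hs'
    rcases Ne.lt_or_gt hs' with h | h
    · refine ⟨s⁻¹, Subgroup.inv_mem _ hs, ?_⟩
      rw [(hφ i).hom.map_inv hs]
      linarith
    · exact ⟨s, hs, h⟩
  choose s hs hs0 using hs
  choose Λ _ hΛ using S.exists_lex hφ
  have hmem : ∀ i, ∀ e : ℤˣ, s i ^ (e : ℤ) ∈ S.term i.castSucc := fun i e =>
    Subgroup.zpow_mem _ (hs i) _
  have hval : ∀ i, ∀ e : ℤˣ, φ i (s i ^ (e : ℤ)) = (e : ℤ) * φ i (s i) := fun i e =>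
    (hφ i).hom.map_zpow (hs i) _
  have hnot : ∀ i, ∀ e : ℤˣ, s i ^ (e : ℤ) ∉ S.term i.succ := fun i e => by
    rw [← (hφ i).ker _ (hmem i e), hval]
    exact mul_ne_zero (by simp) (hs0 i).ne'
  have hpos : ∀ ε i, (Λ ε).IsPositive (s i ^ ((ε i : ℤˣ) : ℤ)) := fun ε i => by
    apply hΛ ε i _ (hmem i _)
    rw [hval, ← mul_assoc]
    rcases Int.units_eq_one_or (ε i) with h | h <;> simp [h, hs0 i]
  have huniq : ∀ ε, ∀ r : LeftOrder G, (∀ i, r.IsPositive (s i ^ ((ε i : ℤˣ) : ℤ))) →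
      r = Λ ε := fun ε r hr =>
    S.order_ext (hS r) (hS _) _ (fun i => hmem i (ε i)) (fun i => hnot i (ε i)) hr (hpos ε)
  have hsurj : Function.Surjective Λ := by
    classical
    intro r
    refine ⟨fun i => if r.IsPositive (s i) then 1 else -1, (huniq _ r fun i => ?_).symm⟩
    by_cases h : r.IsPositive (s i)
    · simp [h]
    · have h1 := hnot i 1
      have := r.isPositive_inv_of_not (x := s i)
        (fun h' => h1 (by simp [h'])) h
      simpa [h] using this
  have hinj : Function.Injective Λ := by
    intro ε ε' h
    funext i
    by_contra hne
    have h1 := hpos ε i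
    have h2 := hpos ε' i
    rw [← h] at h2
    rcases Int.units_eq_one_or (ε i) with h3 | h3 <;>
      rcases Int.units_eq_one_or (ε' i) with h4 | h4
    · exact hne (h3.trans h4.symm)
    · exact (Λ ε).not_isPositive_inv (x := s i) (by simpa [h3] using h1) (by simpa [h4] using h2)
    · exact (Λ ε).not_isPositive_inv (x := s i) (by simpa [h4] using h2) (by simpa [h3] using h1)
    · exact hne (h3.trans h4.symm)
  refine ⟨⟨s, fun i => ⟨hs i, ?_⟩, Λ, fun ε => ⟨hpos ε, huniq ε⟩, hsurj.range_eq⟩, ?_⟩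
  · simpa using hnot i 1
  · rw [← Nat.card_congr (Equiv.ofBijective Λ ⟨hinj, hsurj⟩)]
    simp [Nat.card_eq_fintype_card]

/-- If the terms of a rational series are convex, there are no further convex subgroups. -/
theorem isMaximalConvexSequence (S : RationalSeries G) {r : LeftOrder G}
    (hr : ∀ k, r.ConvexIn (S.term k) ⊤) : r.IsMaximalConvexSequence S.term := by
  refine ⟨S.first, S.last, S.strictAnti, fun H => ⟨fun hH => ?_, ?_⟩⟩
  · rw [LeftOrder.isConvex_iff] at hH
    by_contra! hne
    have hle : ∀ i, H ≤ S.term i := fun i => by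
      induction i using Fin.induction with
      | zero => rw [S.first]; exact le_top
      | succ i ih =>
        rcases (hr i.succ).le_total hH with h | h
        · exfalso
          obtain ⟨φ, hφ⟩ := Tararin.exists_isQuot (S.strict i).le (S.rational i)
          obtain ⟨x, hxH, hxK⟩ := SetLike.exists_of_lt (lt_of_le_of_ne h (hne i.succ))
          obtain ⟨y, hy, hyH⟩ := SetLike.exists_of_lt (lt_of_le_of_ne ih (hne i.castSucc).symm)
          have hx := ih hxH
          have hx0 : φ x ≠ 0 := fun h => hxK ((hφ.ker x hx).mp h)
          wlog hP : r.IsPositive x generalizing x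
          · refine this x⁻¹ (H.inv_mem hxH) (by simpa using hxK) (Subgroup.inv_mem _ hx) ?_
              (r.isPositive_inv_of_not (fun h => hx0 (by rw [h, hφ.hom.map_one])) hP)
            rw [hφ.hom.map_inv hx]
            simpa using hx0
          wlog hPy : r.IsPositive y generalizing y
          · exact this y⁻¹ (Subgroup.inv_mem _ hy) (by simpa using hyH)
              (r.isPositive_inv_of_not (fun h => hyH (h ▸ H.one_mem)) hPy)
          -- Convexity of `H` puts `y` above all powers of `x`, but for this `n` the value of `φ` on
          -- `y * (x ^ n)⁻¹` has the sign opposite to `φ x`.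
          obtain ⟨n, hn⟩ := exists_nat_gt (φ y * φ x / (φ x * φ x))
          rw [div_lt_iff₀ (mul_self_pos.mpr hx0)] at hn
          have h1 := hH y trivial hyH hPy _ (H.inv_mem (H.pow_mem hxH n))
          have hxn := Subgroup.pow_mem _ hx n
          have h2 := Subgroup.mul_mem _ hy (Subgroup.inv_mem _ hxn)
          refine r.not_isPositive_inv h1 (((hr i.succ).mono le_top).isPositive_of_mul_pos hφ hx
            (Subgroup.inv_mem _ h2) ?_ hP)
          rw [hφ.hom.map_inv h2, hφ.hom _ hy _ (Subgroup.inv_mem _ hxn), hφ.hom.map_inv hxn,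
            hφ.hom.map_pow hx]
          linarith
        · exact h
    exact hne (Fin.last _) (le_antisymm (by rw [S.last]; exact bot_le) (hle _))
  · rintro ⟨i, rfl⟩
    exact (r.isConvex_iff _).mpr (hr i)

end RationalSeries

namespace LeftOrder.IsMaximalConvexSequence

theorem length_eq {r : LeftOrder G} {m m' : ℕ} {S : Fin (m + 1) → Subgroup G}
    {S' : Fin (m' + 1) → Subgroup G} (h : r.IsMaximalConvexSequence S)
    (h' : r.IsMaximalConvexSequence S') : m = m' := by
  have hr : Set.range S = Set.range S' := by
    ext H
    exact (h.2.2.2 H).symm.trans (h'.2.2.2 H)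
  have h1 := Nat.card_range_of_injective h.2.2.1.injective
  have h2 := Nat.card_range_of_injective h'.2.2.1.injective
  rw [hr, h2] at h1
  simpa using h1.symm

theorem unique {r : LeftOrder G} {m : ℕ} {S S' : Fin (m + 1) → Subgroup G}
    (h : r.IsMaximalConvexSequence S) (h' : r.IsMaximalConvexSequence S') : S = S' := by
  refine (h.2.2.1.range_inj h'.2.2.1).mp ?_
  ext H
  exact (h.2.2.2 H).symm.trans (h'.2.2.2 H)

end LeftOrder.IsMaximalConvexSequence

/-! ### Convexity forced by quotients that are not bi-orderable -/

theorem IsQuot.exists_pow_mul_mem {K H : Subgroup G} {φ : G → ℚ} (hφ : IsQuot K H φ) {k x : G}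
    (hk : k ∈ H) (hx : x ∈ H) (hxK : x ∉ K) :
    ∃ t n : ℕ, t ≠ 0 ∧ (k ^ t * (x ^ n)⁻¹ ∈ K ∨ k ^ t * x ^ n ∈ K) := by
  have hx0 : φ x ≠ 0 := fun h => hxK ((hφ.ker x hx).mp h)
  refine ⟨(φ k / φ x).den, (φ k / φ x).num.natAbs, (φ k / φ x).den_nz, ?_⟩
  have h2 := Rat.num_div_den (φ k / φ x)
  have h3 : ((φ k / φ x).den : ℚ) ≠ 0 := by exact_mod_cast (φ k / φ x).den_nz
  set d := (φ k / φ x).den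
  set n := (φ k / φ x).num
  have hkd := H.pow_mem hk d
  have hxn := H.pow_mem hx n.natAbs
  rw [← hφ.ker _ (H.mul_mem hkd (H.inv_mem hxn)), ← hφ.ker _ (H.mul_mem hkd hxn),
    hφ.hom _ hkd _ (H.inv_mem hxn), hφ.hom _ hkd _ hxn, hφ.hom.map_inv hxn, hφ.hom.map_pow hk,
    hφ.hom.map_pow hx]
  have h4 : (n : ℚ) * φ x = d * φ k := by
    field_simp at h2
    linarith
  rcases Int.natAbs_eq n with h | h
  · left
    have : (n : ℚ) = (n.natAbs : ℚ) := by
      have := congrArg (Int.cast (R := ℚ)) h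
      rwa [Int.cast_natCast] at this
    rw [← this]
    linarith
  · right
    have : (n : ℚ) = -(n.natAbs : ℚ) := by
      have := congrArg (Int.cast (R := ℚ)) h
      rwa [Int.cast_neg, Int.cast_natCast] at this
    rw [this] at h4
    linarith

/-- A positive `k` acting negatively lies above all of `K`. If `k < z`, then `k * a ^ n * (k⁻¹ * z)`
is positive for positive `a`; it equals `(k * a * k⁻¹) ^ n * z`, which is negative for large `n`. -/
theorem LeftOrder.ConvexIn.lt_of_conj_neg {r : LeftOrder G} {H K L : Subgroup G} {φ ψ : G → ℚ}
    (hφ : IsQuot K H φ) (hψ : IsQuot L K ψ) (hc : r.ConvexIn L K) {k a : G} (hk : k ∈ H)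
    (ha : a ∈ K) (hneg : ψ a * ψ (k * a * k⁻¹) < 0) (hkP : r.IsPositive k) {z : G} (hz : z ∈ K) :
    r.IsPositive (z⁻¹ * k) := by
  by_contra hn
  have hkK : k ∉ K := fun h => by
    rw [hψ.hom.map_conj h ha] at hneg
    exact absurd hneg (not_lt.mpr (mul_self_nonneg _))
  have h1 : r.IsPositive (k⁻¹ * z) := by
    have := r.isPositive_inv_of_not
      (fun h => hkK (by rw [inv_mul_eq_one] at h; rwa [← h])) hn
    simpa using this
  wlog hP : r.IsPositive a generalizing a
  · refine this (K.inv_mem ha) ?_ (r.isPositive_inv_of_not ?_ hP)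
    · have : k * a⁻¹ * k⁻¹ = (k * a * k⁻¹)⁻¹ := by group
      rw [this, hψ.hom.map_inv ha, hψ.hom.map_inv (hφ.conj_mem hk ha)]
      linarith
    · rintro rfl
      rw [hψ.hom.map_one] at hneg
      simp at hneg
  have hb := hφ.conj_mem hk ha
  set b := k * a * k⁻¹
  -- The first bound makes `ψ (b ^ n * z)` opposite in sign to `ψ a`; the second ensures `n ≠ 0`, so
  -- that `a ^ n` is positive.
  obtain ⟨n, hn⟩ := exists_nat_gt (max (ψ a * ψ z / -(ψ a * ψ b)) 0)
  obtain ⟨hn1, hn0⟩ := max_lt_iff.mp hn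
  rw [div_lt_iff₀ (by linarith)] at hn1
  have hbn := K.pow_mem hb n
  have h2 : r.IsPositive (b ^ n * z) := by
    have h3 := r.isPositive_mul (r.isPositive_mul hkP
      (r.isPositive_pow hP (n := n) (by rintro rfl; simp at hn0))) h1
    have h4 : b ^ n = k * a ^ n * k⁻¹ := conj_pow
    rw [h4]
    simpa [mul_assoc] using h3
  refine r.not_isPositive_inv h2
    (hc.isPositive_of_mul_pos hψ ha (K.inv_mem (K.mul_mem hbn hz)) ?_ hP)
  rw [hψ.hom.map_inv (K.mul_mem hbn hz), hψ.hom _ hbn _ hz, hψ.hom.map_pow hb]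
  linarith

/-- If some element acts on `K / L` by a negative factor, then `K` is convex. -/
theorem LeftOrder.ConvexIn.of_conj_neg {r : LeftOrder G} {H K L : Subgroup G} {φ ψ : G → ℚ}
    (hφ : IsQuot K H φ) (hψ : IsQuot L K ψ) (hc : r.ConvexIn L K) {k a : G} (hk : k ∈ H)
    (ha : a ∈ K) (hneg : ψ a * ψ (k * a * k⁻¹) < 0) : r.ConvexIn K H := by
  wlog hkP : r.IsPositive k generalizing k a
  · refine this (a := k * a * k⁻¹) (H.inv_mem hk) (hφ.conj_mem hk ha) ?_
      (r.isPositive_inv_of_not ?_ hkP)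
    · have : k⁻¹ * (k * a * k⁻¹) * k⁻¹⁻¹ = a := by group
      rw [this]
      linarith
    · rintro rfl
      simp only [one_mul, inv_one, mul_one] at hneg
      exact absurd hneg (not_lt.mpr (mul_self_nonneg _))
  suffices hleft : ∀ x ∈ H, x ∉ K → r.IsPositive x → ∀ h ∈ K, r.IsPositive (h * x) by
    intro x hx hxK hP h hh
    simpa using hleft x hx hxK hP _ (hφ.conj_mem hx hh)
  intro x hx hxK hP h hh
  by_contra hn
  have h1 := r.isPositive_inv_of_not
    (fun h' => hxK (by rw [← inv_eq_of_mul_eq_one_right h']; exact K.inv_mem hh)) hn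
  rw [mul_inv_rev] at h1
  -- From `x < h⁻¹` it follows that every power of `x` is bounded above by an element of `K`. The
  -- powers of `k` are not, and some power of `k` agrees modulo `K` with a power of `x` or `x⁻¹`.
  have hbound : ∀ s : ℕ, ∃ u ∈ K, r.IsPositive ((x ^ (s + 1))⁻¹ * u) := by
    intro s
    induction s with
    | zero => exact ⟨h⁻¹, K.inv_mem hh, by simpa using h1⟩
    | succ s ih =>
      obtain ⟨u, hu, hPu⟩ := ih
      refine ⟨x * u * x⁻¹ * h⁻¹, K.mul_mem (hφ.conj_mem hx hu) (K.inv_mem hh), ?_⟩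
      have := r.isPositive_mul hPu h1
      rw [pow_succ' x (s + 1)]
      convert this using 1
      group
  have hbig : ∀ t : ℕ, t ≠ 0 → ∀ z ∈ K, r.IsPositive (z⁻¹ * k ^ t) := by
    intro t ht z hz
    have h2 := hc.lt_of_conj_neg hφ hψ hk ha hneg hkP hz
    obtain ⟨t, rfl⟩ := Nat.exists_eq_succ_of_ne_zero ht
    rcases eq_or_ne t 0 with rfl | h0
    · simpa using h2
    · rw [Nat.succ_eq_add_one, pow_succ', ← mul_assoc]
      exact r.isPositive_mul h2 (r.isPositive_pow hkP h0)
  obtain ⟨t, n, ht, h3 | h3⟩ := hφ.exists_pow_mul_mem hk hx hxK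
  · rcases n with - | n
    · have := hbig t ht _ h3
      simp at this
      exact r.not_isPositive_one this
    · obtain ⟨u, hu, hPu⟩ := hbound n
      have := hbig t ht _ (K.mul_mem h3 hu)
      refine r.not_isPositive_inv hPu ?_
      convert this using 1
      group
  · have := hbig t ht _ h3
    rcases n with - | n
    · simp at this
      exact r.not_isPositive_one this
    · refine r.not_isPositive_inv (r.isPositive_pow hP n.succ_ne_zero) ?_
      rwa [mul_inv_rev, inv_mul_cancel_right] at this

/-- The lexicographic cone, first by `φ` and then by `ψ`, is conjugation invariant: `φ` is so
automatically, and `ψ` keeps its positive elements by `hpos`. -/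
theorem isBiOrderable_of_conj_pos {H K L : Subgroup G} {φ ψ : G → ℚ}
    (hφ : IsQuot K H φ) (hψ : IsQuot L K ψ) [hn : (L.subgroupOf H).Normal]
    (hpos : ∀ k ∈ H, ∀ a ∈ K, 0 < ψ a → 0 < ψ (k * a * k⁻¹)) :
    IsBiOrderable (H ⧸ L.subgroupOf H) := by
  let Q : G → Prop := fun x => 0 < φ x ∨ (x ∈ K ∧ 0 < ψ x)
  have hφK : ∀ x ∈ K, φ x = 0 := fun x hx => (hφ.ker x (hφ.le hx)).mpr hx
  have hQL : ∀ x ∈ L, ¬ Q x := by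
    rintro x hx (h | ⟨_, h⟩)
    · rw [hφK x (hψ.le hx)] at h
      exact lt_irrefl _ h
    · rw [(hψ.ker x (hψ.le hx)).mpr hx] at h
      exact lt_irrefl _ h
  have hQmul : ∀ x ∈ H, ∀ y ∈ H, Q x → Q y → Q (x * y) := by
    rintro x hx y hy (h | ⟨h, h'⟩) (h2 | ⟨h2, h2'⟩)
    · exact Or.inl (by rw [hφ.hom _ hx _ hy]; exact add_pos h h2)
    · exact Or.inl (by rwa [hφ.hom _ hx _ hy, hφK y h2, add_zero])
    · exact Or.inl (by rwa [hφ.hom _ hx _ hy, hφK x h, zero_add])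
    · exact Or.inr ⟨K.mul_mem h h2, by rw [hψ.hom _ h _ h2]; exact add_pos h' h2'⟩
  have hQconj : ∀ x ∈ H, ∀ y ∈ H, Q x → Q (y * x * y⁻¹) := by
    rintro x hx y hy (h | ⟨h, h'⟩)
    · exact Or.inl (by rwa [hφ.hom.map_conj hy hx])
    · exact Or.inr ⟨hφ.conj_mem hy h, hpos y hy x h h'⟩
  have hQtot : ∀ x ∈ H, x ∉ L → Q x ∨ Q x⁻¹ := by
    intro x hx hxL
    by_cases hxK : x ∈ K
    · have : ψ x ≠ 0 := fun h => hxL ((hψ.ker x hxK).mp h)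
      rcases this.lt_or_gt with h | h
      · exact Or.inr (Or.inr ⟨K.inv_mem hxK, by rw [hψ.hom.map_inv hxK]; linarith⟩)
      · exact Or.inl (Or.inr ⟨hxK, h⟩)
    · have : φ x ≠ 0 := fun h => hxK ((hφ.ker x hx).mp h)
      rcases this.lt_or_gt with h | h
      · exact Or.inr (Or.inl (by rw [hφ.hom.map_inv hx]; linarith))
      · exact Or.inl (Or.inl h)
  let P : H ⧸ L.subgroupOf H → Prop := fun a => ∃ x : H, QuotientGroup.mk x = a ∧ Q x
  refine ⟨LeftOrder.ofCone P ?_ ?_ ?_, ?_⟩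
  · rintro ⟨x, hx, hQ⟩
    rw [QuotientGroup.eq_one_iff, Subgroup.mem_subgroupOf] at hx
    exact hQL _ hx hQ
  · rintro _ _ ⟨x, rfl, hx⟩ ⟨y, rfl, hy⟩
    exact ⟨x * y, rfl, hQmul _ x.2 _ y.2 hx hy⟩
  · intro a ha
    induction a using QuotientGroup.induction_on with
    | H x =>
      rw [Ne, QuotientGroup.eq_one_iff, Subgroup.mem_subgroupOf] at ha
      rcases hQtot x x.2 ha with h | h
      · exact Or.inl ⟨x, rfl, h⟩
      · exact Or.inr ⟨x⁻¹, rfl, h⟩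
  · intro f g h hfg
    rw [LeftOrder.lt_iff, LeftOrder.ofCone_isPositive] at hfg ⊢
    obtain ⟨x, hx, hQ⟩ := hfg
    induction h using QuotientGroup.induction_on with
    | H z =>
      refine ⟨z⁻¹ * x * z, ?_, ?_⟩
      · rw [QuotientGroup.mk_mul, QuotientGroup.mk_mul, hx, QuotientGroup.mk_inv]
        group
      · simpa using hQconj x x.2 z⁻¹ (H.inv_mem z.2) hQ

namespace RationalSeries

theorem NonBiOrderableQuotients.convexIn {S : RationalSeries G} (hS : S.NonBiOrderableQuotients)
    (r : LeftOrder G) (i : Fin S.length) : r.ConvexIn (S.term i.succ) (S.term i.castSucc) := by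
  obtain ⟨φ, hφ⟩ := S.exists_isQuot
  suffices ∀ d : ℕ, ∀ i : Fin S.length, (i : ℕ) + d + 1 = S.length →
      r.ConvexIn (S.term i.succ) (S.term i.castSucc) from
    this (S.length - i - 1) i (by omega)
  intro d
  -- Induction on the distance from the bottom: convexity of `L` in `K` is needed to get that of `K`
  -- in `H`.
  induction d with
  | zero =>
    intro i hi
    have : i.succ = Fin.last _ := by ext; simpa using hi
    rw [this, S.last]
    rintro x _ _ hP h hh
    rw [Subgroup.mem_bot] at hh
    rwa [hh, mul_one]
  | succ d ih =>
    intro i hi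
    let j : Fin S.length := ⟨i + 1, by omega⟩
    have hj : j.castSucc = i.succ := rfl
    have h1 := ih j (by simp [j]; omega)
    have hψ := hφ j
    rw [hj] at h1 hψ
    obtain ⟨hn, hnb⟩ := hS i.castSucc j.succ (by simp [j])
    have : ∃ k ∈ S.term i.castSucc, ∃ a ∈ S.term i.succ, 0 < φ j a ∧ φ j (k * a * k⁻¹) ≤ 0 := by
      by_contra! hcon
      exact hnb (isBiOrderable_of_conj_pos (hφ i) hψ hcon)
    obtain ⟨k, hk, a, ha, ha0, hka⟩ := this
    refine LeftOrder.ConvexIn.of_conj_neg (hφ i) hψ h1 hk ha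
      (mul_neg_of_pos_of_neg ha0 (lt_of_le_of_ne hka fun h0 => ?_))
    -- The value cannot be zero: normality of `G_{i+2}` in `G_i` would put `a` itself into
    -- `G_{i+2}`.
    have hmem := (hψ.ker _ ((hφ i).conj_mem hk ha)).mp h0
    have h2 := hn.conj_mem ⟨k * a * k⁻¹, (hφ i).le ((hφ i).conj_mem hk ha)⟩
      (Subgroup.mem_subgroupOf.mpr hmem) ⟨k, hk⟩⁻¹
    rw [Subgroup.mem_subgroupOf] at h2
    have h3 : a ∈ S.term j.succ := by
      convert h2 using 1
      simp [mul_assoc]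
    rw [(hψ.ker a ha).mpr h3] at ha0
    exact lt_irrefl _ ha0

theorem convexIn_top (S : RationalSeries G) {r : LeftOrder G}
    (hr : ∀ i : Fin S.length, r.ConvexIn (S.term i.succ) (S.term i.castSucc))
    (k : Fin (S.length + 1)) : r.ConvexIn (S.term k) ⊤ := by
  induction k using Fin.induction with
  | zero =>
    rw [S.first]
    exact fun x _ hx => absurd trivial hx
  | succ i ih => exact (hr i).trans ih (S.strict i).le

end RationalSeries

/-! ### Automorphisms acting on orders, and modification on convex subgroups -/

namespace LeftOrder

/-- The image of a left order under an automorphism. -/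
def map (e : MulAut G) (r : LeftOrder G) : LeftOrder G :=
  ofCone (fun x => r.IsPositive (e⁻¹ x)) (by simpa using r.not_isPositive_one)
    (fun x y hx hy => by rw [_root_.map_mul]; exact r.isPositive_mul hx hy)
    (fun x hx => by
      rw [_root_.map_inv]
      exact (r.isPositive_or (e⁻¹ x)).resolve_left (by simpa using hx))

theorem map_isPositive (e : MulAut G) (r : LeftOrder G) (x : G) :
    (r.map e).IsPositive x ↔ r.IsPositive (e⁻¹ x) := ofCone_isPositive ..

instance : MulAction (MulAut G) (LeftOrder G) where
  smul e r := r.map e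
  one_smul r := ext_isPositive fun x => map_isPositive 1 r x
  mul_smul e e' r := ext_isPositive fun x =>
    (map_isPositive (e * e') r x).trans
      ((map_isPositive e (r.map e') x).trans (map_isPositive e' r (e⁻¹ x))).symm

theorem smul_isPositive (e : MulAut G) (r : LeftOrder G) (x : G) :
    (e • r).IsPositive x ↔ r.IsPositive (e⁻¹ x) := map_isPositive e r x

/-- Left orders on a group with finitely many of them are invariant under conjugation by
sufficiently divisible powers. -/
theorem exists_pow_conj_isPositive (G : Type*) [Group G] [Finite (LeftOrder G)] :
    ∃ m : ℕ, m ≠ 0 ∧ ∀ (r : LeftOrder G) (g x : G),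
      r.IsPositive (g ^ m * x * (g ^ m)⁻¹) ↔ r.IsPositive x := by
  -- The order of the permutation group of the set of left orders kills the permutation induced by
  -- any conjugation.
  refine ⟨Nat.card (Equiv.Perm (LeftOrder G)), Nat.card_pos.ne', fun r g x => ?_⟩
  set m := Nat.card (Equiv.Perm (LeftOrder G))
  have h1 : MulAction.toPermHom (MulAut G) (LeftOrder G) (MulAut.conj g ^ m) = 1 := by
    rw [_root_.map_pow]
    exact pow_card_eq_one'
  have h2 : (MulAut.conj g ^ m) • r = r := by
    simpa using congrArg (fun f : Equiv.Perm (LeftOrder G) => f r) h1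
  rw [← _root_.map_pow] at h2
  have h3 := smul_isPositive (MulAut.conj (g ^ m)) r (g ^ m * x * (g ^ m)⁻¹)
  rw [h2, ← _root_.map_inv, MulAut.conj_apply] at h3
  simpa [mul_assoc] using h3

theorem ConvexIn.smul {r : LeftOrder G} {K : Subgroup G} (h : r.ConvexIn K ⊤) (e : MulAut G) :
    (e • r).ConvexIn (K.map e.toMonoidHom) ⊤ := by
  intro x _ hxK hP y hy
  rw [smul_isPositive] at hP ⊢
  rw [_root_.map_mul]
  have hmem : ∀ z, z ∈ K.map e.toMonoidHom ↔ e⁻¹ z ∈ K := fun z => by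
    rw [Subgroup.mem_map_equiv]
    rfl
  rw [hmem] at hxK hy
  exact h _ trivial hxK hP _ hy

/-- Replacing an order on a convex subgroup by the lexicographic order with respect to a
rational-valued cocycle. -/
theorem ConvexIn.exists_modify {r : LeftOrder G} {C : Subgroup G} (hC : r.ConvexIn C ⊤)
    {q ψ : G → ℚ} (hq : ∀ x ∈ C, 0 < q x)
    (hψ : ∀ x ∈ C, ∀ y ∈ C, ψ (x * y) = ψ x + q x * ψ y) :
    ∃ r' : LeftOrder G, ∀ x ∈ C, 0 < ψ x → r'.IsPositive x := by
  have hone : ψ 1 = 0 := by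
    have := hψ 1 C.one_mem 1 C.one_mem
    rw [mul_one, left_eq_add] at this
    exact (mul_eq_zero.mp this).resolve_left (hq 1 C.one_mem).ne'
  have hinv : ∀ x ∈ C, q x * ψ x⁻¹ = - ψ x := fun x hx => by
    have := hψ x hx x⁻¹ (C.inv_mem hx)
    rw [mul_inv_cancel, hone] at this
    linarith
  -- Here `C` acts on `ℚ` by `t ↦ q x * t + ψ x`, and `ψ x` is the displacement of `0`. Elements
  -- fixing `0`, and those outside `C`, keep their old sign.
  let P : G → Prop := fun x => (x ∈ C ∧ 0 < ψ x) ∨ ((x ∈ C → ψ x = 0) ∧ r.IsPositive x)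
  have h1 : ¬ P 1 := by
    rintro (⟨_, h⟩ | ⟨_, h⟩)
    · rw [hone] at h
      exact lt_irrefl _ h
    · exact r.not_isPositive_one h
  have hmul : ∀ x y, P x → P y → P (x * y) := by
    rintro x y (⟨hx, hx'⟩ | ⟨hx, hx'⟩) (⟨hy, hy'⟩ | ⟨hy, hy'⟩)
    · refine Or.inl ⟨C.mul_mem hx hy, ?_⟩
      rw [hψ x hx y hy]
      exact add_pos hx' (mul_pos (hq x hx) hy')
    · by_cases hyC : y ∈ C
      · exact Or.inl ⟨C.mul_mem hx hyC, by rwa [hψ x hx y hyC, hy hyC, mul_zero, add_zero]⟩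
      · exact Or.inr ⟨fun h => absurd ((C.mul_mem_cancel_left hx).mp h) hyC,
          hC.left le_top trivial hyC hy' hx⟩
    · by_cases hxC : x ∈ C
      · exact Or.inl ⟨C.mul_mem hxC hy, by
          rw [hψ x hxC y hy, hx hxC, zero_add]
          exact mul_pos (hq x hxC) hy'⟩
      · exact Or.inr ⟨fun h => absurd ((C.mul_mem_cancel_right hy).mp h) hxC,
          hC x trivial hxC hx' y hy⟩
    · refine Or.inr ⟨fun hxy => ?_, r.isPositive_mul hx' hy'⟩
      by_cases hyC : y ∈ C
      · have hxC := (C.mul_mem_cancel_right hyC).mp hxy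
        rw [hψ x hxC y hyC, hx hxC, hy hyC, mul_zero, add_zero]
      · have := hC y trivial hyC hy' _ (C.inv_mem hxy)
        exact absurd (by simpa using this) (r.not_isPositive_inv hx')
  have htot : ∀ x, x ≠ 1 → P x ∨ P x⁻¹ := by
    intro x hx
    by_cases h : x ∈ C → ψ x = 0
    · rcases (r.isPositive_or x).resolve_left hx with h' | h'
      · exact Or.inl (Or.inr ⟨h, h'⟩)
      · refine Or.inr (Or.inr ⟨fun hxC => ?_, h'⟩)
        rw [C.inv_mem_iff] at hxC
        have := hinv x hxC
        rw [h hxC, neg_zero] at this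
        exact (mul_eq_zero.mp this).resolve_left (hq x hxC).ne'
    · push Not at h
      rcases h.2.lt_or_gt with h' | h'
      · refine Or.inr (Or.inl ⟨C.inv_mem h.1, ?_⟩)
        have := hinv x h.1
        exact pos_of_mul_pos_right (by linarith) (hq x h.1).le
      · exact Or.inl (Or.inl ⟨h.1, h'⟩)
  refine ⟨ofCone P h1 hmul htot, fun x hx hpos => ?_⟩
  rw [ofCone_isPositive]
  exact Or.inl ⟨hx, hpos⟩

/-- On a convex subgroup, any two rational-valued homomorphisms are proportional if there are only
finitely many left orders. -/
theorem ConvexIn.hom_dependent [Finite (LeftOrder G)] {r : LeftOrder G} {C : Subgroup G}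
    (hC : r.ConvexIn C ⊤) {ψ₁ ψ₂ : G → ℚ} (h₁ : IsHomOn C ψ₁) (h₂ : IsHomOn C ψ₂) {a b : G}
    (ha : a ∈ C) (hb : b ∈ C) : ψ₁ a * ψ₂ b = ψ₁ b * ψ₂ a := by
  by_contra hne
  have hD := sub_ne_zero.mpr hne
  set D := ψ₁ a * ψ₂ b - ψ₁ b * ψ₂ a with hDdef
  -- Cramer's rule prescribes the values at `a` and `b`. Half-integers keep `b * (a ^ k)⁻¹` off the
  -- kernel; for `n < k` its sign separates the orders built from `ψ n` and `ψ k`.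
  have key : ∀ n : ℕ, ∃ ψ : G → ℚ, IsHomOn C ψ ∧ ψ a = 1 ∧ ψ b = n + 1 / 2 := fun n => by
    refine ⟨fun x => ((ψ₂ b - (n + 1 / 2) * ψ₂ a) / D) * ψ₁ x +
      (((n + 1 / 2) * ψ₁ a - ψ₁ b) / D) * ψ₂ x, fun x hx y hy => ?_, ?_, ?_⟩
    · simp only [h₁ x hx y hy, h₂ x hx y hy]
      ring
    · field_simp
      rw [hDdef]
      ring
    · field_simp
      rw [hDdef]
      ring
  choose ψ hψ hψa hψb using key
  choose s hs using fun n => hC.exists_modify (q := fun _ => 1) (ψ := ψ n)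
    (fun _ _ => one_pos) (fun x hx y hy => by rw [hψ n x hx y hy, one_mul])
  refine not_injective_infinite_finite s (.of_lt_imp_ne fun n k hnk heq => ?_)
  have hak := C.pow_mem ha k
  have hmem := C.mul_mem hb (C.inv_mem hak)
  have hval : ∀ n, ψ n (b * (a ^ k)⁻¹) = n + 1 / 2 - k := fun n => by
    rw [hψ n _ hb _ (C.inv_mem hak), (hψ n).map_inv hak, (hψ n).map_pow ha, hψa, hψb]
    ring
  have hp := hs k _ hmem (by rw [hval]; norm_num)
  refine (s k).not_isPositive_inv hp ?_
  rw [← heq]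
  refine hs n _ (C.inv_mem hmem) ?_
  rw [(hψ n).map_inv hmem, hval]
  have : (n : ℚ) + 1 ≤ k := by exact_mod_cast hnk
  linarith

/-- Reversing an order on a convex subgroup. -/
theorem ConvexIn.exists_flip {r : LeftOrder G} {C : Subgroup G} (hC : r.ConvexIn C ⊤) :
    ∃ r' : LeftOrder G, (∀ x ∈ C, r'.IsPositive x ↔ r.IsPositive x⁻¹) ∧
      ∀ x ∉ C, r'.IsPositive x ↔ r.IsPositive x := by
  let P : G → Prop := fun x => (x ∈ C ∧ r.IsPositive x⁻¹) ∨ (x ∉ C ∧ r.IsPositive x)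
  have h1 : ¬ P 1 := by
    rintro (⟨_, h⟩ | ⟨_, h⟩)
    · rw [inv_one] at h
      exact r.not_isPositive_one h
    · exact r.not_isPositive_one h
  have hmul : ∀ x y, P x → P y → P (x * y) := by
    rintro x y (⟨hx, hx'⟩ | ⟨hx, hx'⟩) (⟨hy, hy'⟩ | ⟨hy, hy'⟩)
    · exact Or.inl ⟨C.mul_mem hx hy, by rw [mul_inv_rev]; exact r.isPositive_mul hy' hx'⟩
    · exact Or.inr ⟨fun h => hy ((C.mul_mem_cancel_left hx).mp h),
        hC.left le_top trivial hy hy' hx⟩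
    · exact Or.inr ⟨fun h => hx ((C.mul_mem_cancel_right hy).mp h), hC x trivial hx hx' y hy⟩
    · refine Or.inr ⟨fun hxy => ?_, r.isPositive_mul hx' hy'⟩
      have := hC y trivial hy hy' _ (C.inv_mem hxy)
      exact absurd (by simpa using this) (r.not_isPositive_inv hx')
  have htot : ∀ x, x ≠ 1 → P x ∨ P x⁻¹ := by
    intro x hx
    have h := (r.isPositive_or x).resolve_left hx
    by_cases hxC : x ∈ C
    · rcases h with h | h
      · exact Or.inr (Or.inl ⟨C.inv_mem hxC, by simpa using h⟩)
      · exact Or.inl (Or.inl ⟨hxC, h⟩)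
    · rcases h with h | h
      · exact Or.inl (Or.inr ⟨hxC, h⟩)
      · exact Or.inr (Or.inr ⟨by simpa using hxC, h⟩)
  refine ⟨ofCone P h1 hmul htot, fun x hx => ?_, fun x hx => ?_⟩
  · rw [ofCone_isPositive]
    simp [P, hx]
  · rw [ofCone_isPositive]
    simp [P, hx]

/-- Flipping on distinct convex subgroups gives distinct orders: an element of one but not of the
other changes sign only once. -/
theorem finite_convex [Finite (LeftOrder G)] (r : LeftOrder G) :
    Finite {H : Subgroup G // r.ConvexIn H ⊤} := by
  choose f hf hf' using fun H : {H : Subgroup G // r.ConvexIn H ⊤} => H.2.exists_flip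
  refine Finite.of_injective f fun H K heq => ?_
  have key : ∀ H K : {H : Subgroup G // r.ConvexIn H ⊤}, f H = f K → H.1 ≤ K.1 := by
    intro H K heq x hx
    by_contra hxK
    have h1 := hf H x hx
    rw [heq, hf' K x hxK] at h1
    rcases r.isPositive_or x with rfl | h | h
    · exact hxK K.1.one_mem
    · exact r.not_isPositive_inv h (h1.mp h)
    · exact r.not_isPositive_inv (h1.mpr h) h
  exact Subtype.ext (le_antisymm (key H K heq) (key K H heq.symm))

end LeftOrder

/-! ### Hölder's theorem -/

namespace LeftOrder

section Hoelder

variable {Q : Type*} [Group Q] {r : LeftOrder Q}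

/-- If `z⁻¹` is positive, some `x ^ n` exceeds it, so `(z * x * z⁻¹) ^ n = (z * x ^ n) * z⁻¹` is
positive, and so is its root. Positive `z` reduces to this case by conjugating back. -/
theorem isPositive_conj_of_archimedean (harch : ∀ g x, r.IsPositive g → ∃ n : ℕ,
    r.IsPositive (x⁻¹ * g ^ n)) (z x : Q) (hx : r.IsPositive x) : r.IsPositive (z * x * z⁻¹) := by
  have key : ∀ z x : Q, r.IsPositive z⁻¹ → r.IsPositive x → r.IsPositive (z * x * z⁻¹) := by
    intro z x hz hx
    obtain ⟨n, hn⟩ := harch x z⁻¹ hx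
    rw [inv_inv] at hn
    have := r.isPositive_mul hn hz
    rw [← conj_pow] at this
    exact r.isPositive_of_pow this
  rcases r.isPositive_or z with rfl | h | h
  · simpa using hx
  · by_contra hn
    have h1 := r.isPositive_inv_of_not (fun h' => ?_) hn
    · have h2 := key z⁻¹ _ (by simpa using h) h1
      refine r.not_isPositive_inv hx ?_
      convert h2 using 1
      group
    · rw [conj_eq_one_iff] at h'
      exact r.not_isPositive_one (h' ▸ hx)
  · exact key z x h hx

/-- Integer parts with respect to a positive element of an Archimedean order. -/
theorem exists_floor_of_archimedean (harch : ∀ g x, r.IsPositive g → ∃ n : ℕ,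
    r.IsPositive (x⁻¹ * g ^ n)) {d : Q} (hd : r.IsPositive d) (x : Q) :
    ∃ i : ℤ, ¬ r.IsPositive (x⁻¹ * d ^ i) ∧ r.IsPositive (x⁻¹ * d ^ (i + 1)) := by
  have hmono : ∀ i j : ℤ, i ≤ j → r.IsPositive (x⁻¹ * d ^ i) → r.IsPositive (x⁻¹ * d ^ j) := by
    intro i j hij h
    obtain ⟨k, rfl⟩ := Int.le.dest hij
    rw [zpow_add, ← mul_assoc, zpow_natCast]
    rcases eq_or_ne k 0 with rfl | hk
    · simpa using h
    · exact r.isPositive_mul h (r.isPositive_pow hd hk)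
  obtain ⟨n, hn⟩ := harch d x hd
  obtain ⟨k, hk⟩ := harch d x⁻¹ hd
  have hlow : ¬ r.IsPositive (x⁻¹ * d ^ (-(k : ℤ))) := by
    intro h
    refine r.not_isPositive_inv hk ?_
    convert isPositive_conj_of_archimedean harch (d ^ (-(k : ℤ))) _ h using 1
    simp [mul_assoc]
  obtain ⟨i, hi, hmax⟩ := Int.exists_greatest_of_bdd
    (P := fun i => ¬ r.IsPositive (x⁻¹ * d ^ i))
    ⟨n, fun i hi => by
      by_contra hlt
      exact hi (hmono n i (not_le.mp hlt).le (by simpa using hn))⟩ ⟨_, hlow⟩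
  refine ⟨i, hi, ?_⟩
  by_contra h
  exact absurd (hmax _ h) (by omega)

theorem not_isPositive_mul {x y : Q} (hx : ¬ r.IsPositive x) (hy : ¬ r.IsPositive y) :
    ¬ r.IsPositive (x * y) := by
  intro h
  rcases eq_or_ne x 1 with rfl | hx1
  · exact hy (by simpa using h)
  · exact hy (by simpa using r.isPositive_mul (r.isPositive_inv_of_not hx1 hx) h)

/-- Archimedean left orders exist only on abelian groups. -/
theorem mul_comm_of_archimedean (harch : ∀ g x, r.IsPositive g → ∃ n : ℕ,
    r.IsPositive (x⁻¹ * g ^ n)) (x y : Q) : x * y = y * x := by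
  by_contra hne
  wlog hP : r.IsPositive (x * y * (y * x)⁻¹) generalizing x y
  · refine this y x (Ne.symm hne) ?_
    have := r.isPositive_inv_of_not (fun h => hne (mul_inv_eq_one.mp h)) hP
    simpa [mul_assoc] using this
  have hconj := isPositive_conj_of_archimedean harch
  have hconj' : ∀ z x, ¬ r.IsPositive x → ¬ r.IsPositive (z * x * z⁻¹) := fun z x hx h => by
    refine hx ?_
    convert hconj z⁻¹ _ h using 1
    group
  -- With a least positive element the group is cyclic. Otherwise some positive `δ` satisfies `δ * δ
  -- ≤ c` for the commutator `c`.
  by_cases hmin : ∃ e, r.IsPositive e ∧ ∀ x, r.IsPositive x → ¬ r.IsPositive (x⁻¹ * e)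
  · obtain ⟨e, he, hmin⟩ := hmin
    have hpow : ∀ x, ∃ i : ℤ, x = e ^ i := by
      intro x
      obtain ⟨i, hi, hi'⟩ := exists_floor_of_archimedean harch he x
      refine ⟨i, ?_⟩
      by_contra hx
      have := r.isPositive_inv_of_not (fun h => hx (inv_mul_eq_one.mp h)) hi
      refine hmin _ this ?_
      rwa [inv_inv, mul_assoc, ← zpow_add_one]
    obtain ⟨i, rfl⟩ := hpow x
    obtain ⟨j, rfl⟩ := hpow y
    exact hne (by rw [← zpow_add, ← zpow_add, add_comm])
  · push Not at hmin
    set c := x * y * (y * x)⁻¹ with hc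
    obtain ⟨d, hd, hdc⟩ := hmin c hP
    obtain ⟨δ, hδ, hδc⟩ : ∃ δ, r.IsPositive δ ∧ ¬ r.IsPositive (c⁻¹ * (δ * δ)) := by
      by_cases h : r.IsPositive (c⁻¹ * (d * d))
      · refine ⟨d⁻¹ * c, hdc, fun h' => ?_⟩
        refine r.not_isPositive_inv (hconj c _ h') ?_
        convert hconj d _ h using 1
        group
      · exact ⟨d, hd, h⟩
    -- From `δ ^ i ≤ x < δ ^ (i + 1)` and `δ ^ j ≤ y < δ ^ (j + 1)` comes `x * y < δ ^ (i + j + 2)`,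
    -- while `x * y = c * (y * x) ≥ δ ^ (i + j + 2)`.
    obtain ⟨i, hi, hi'⟩ := exists_floor_of_archimedean harch hδ x
    obtain ⟨j, hj, hj'⟩ := exists_floor_of_archimedean harch hδ y
    have h1 := r.isPositive_mul (hconj y⁻¹ _ hi') hj'
    have h2 := not_isPositive_mul (hconj' x⁻¹ _ hj) hi
    have h3 := not_isPositive_mul (hconj' (y * x)⁻¹ _ hδc) h2
    refine h3 ?_
    convert h1 using 1
    have e1 : y⁻¹ * (x⁻¹ * δ ^ (i + 1)) * y⁻¹⁻¹ * (y⁻¹ * δ ^ (j + 1)) =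
        (x * y)⁻¹ * (δ * δ * δ ^ (j + i)) := by
      have : δ * δ * δ ^ (j + i) = δ ^ (i + 1) * δ ^ (j + 1) := by
        rw [← zpow_add, mul_assoc, ← zpow_one_add, ← zpow_one_add]
        congr 1
        ring
      rw [this]
      group
    have e2 : (y * x)⁻¹ * (c⁻¹ * (δ * δ)) * (y * x)⁻¹⁻¹ *
        (x⁻¹ * (y⁻¹ * δ ^ j) * x⁻¹⁻¹ * (x⁻¹ * δ ^ i)) =
        (c * (y * x))⁻¹ * (δ * δ * δ ^ (j + i)) := by
      rw [zpow_add]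
      group
    rw [e1, e2, hc, inv_mul_cancel_right]

/-- Hölder's theorem: an Archimedean left-ordered group embeds into the reals. -/
theorem exists_real_embedding (harch : ∀ g x, r.IsPositive g → ∃ n : ℕ,
    r.IsPositive (x⁻¹ * g ^ n)) :
    ∃ φ : Q → ℝ, (∀ x y, φ (x * y) = φ x + φ y) ∧ ∀ x, φ x = 0 ↔ x = 1 := by
  classical
  let : CommGroup Q := { ‹Group Q› with mul_comm := mul_comm_of_archimedean harch }
  let : LinearOrder Q :=
    { le := fun a b => ¬ r.lt b a
      lt := r.lt
      le_refl := r.irrefl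
      le_trans := fun a b c hab hbc hca => by
        rcases r.total a b with h | rfl | h
        · exact hbc (r.trans _ _ _ hca h)
        · exact hbc hca
        · exact hab h
      le_antisymm := fun a b hab hba => by
        rcases r.total a b with h | h | h
        · exact absurd h hba
        · exact h
        · exact absurd h hab
      le_total := fun a b => by
        rw [or_iff_not_imp_left, not_not]
        exact fun h h' => r.irrefl _ (r.trans _ _ _ h h')
      lt_iff_le_not_ge := fun a b => by
        constructor
        · exact fun h => ⟨fun h' => r.irrefl _ (r.trans _ _ _ h h'), not_not.mpr h⟩
        · exact fun h => not_not.mp h.2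
      toDecidableLE := Classical.decRel _ }
  have hlt : ∀ a b : Q, a < b ↔ r.lt a b := fun _ _ => Iff.rfl
  have : IsOrderedMonoid Q :=
    { mul_le_mul_left := fun a b hab c => by
        by_contra h
        rw [not_le, hlt, mul_comm b, mul_comm a] at h
        refine hab ?_
        simpa using r.mul_left _ _ c⁻¹ h }
  have : MulArchimedean Q := ⟨fun x y hy => by
    obtain ⟨n, hn⟩ := harch y x hy
    exact ⟨n, le_of_lt ((hlt _ _).mpr ((r.lt_iff _ _).mpr hn))⟩⟩
  obtain ⟨f, hf⟩ := Archimedean.exists_orderAddMonoidHom_real_injective (Additive Q)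
  refine ⟨fun x => f (Additive.ofMul x), fun x y => ?_, fun x => ?_⟩
  · exact _root_.map_add f _ _
  · rw [map_eq_zero_iff f hf]
    exact ofMul_eq_zero

end Hoelder

end LeftOrder

/-! ### Jumps of convex subgroups are rational -/

namespace LeftOrder

/-- `K < H` are convex subgroups without convex subgroups strictly between them. -/
structure IsJump (r : LeftOrder G) (K H : Subgroup G) : Prop where
  lt : K < H
  convex_left : r.ConvexIn K ⊤
  convex_right : r.ConvexIn H ⊤
  eq_or_eq : ∀ L : Subgroup G, r.ConvexIn L ⊤ → K ≤ L → L ≤ H → L = K ∨ L = H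

section

variable {r : LeftOrder G} {m : ℕ}

/-- The convex subgroup generated by a positive element. -/
theorem exists_hull (hm0 : m ≠ 0)
    (hm : ∀ g x : G, r.IsPositive (g ^ m * x * (g ^ m)⁻¹) ↔ r.IsPositive x) {g : G}
    (hg : r.IsPositive g) :
    ∃ D : Subgroup G, g ∈ D ∧ r.ConvexIn D ⊤ ∧ ∀ x ∈ D, ∃ n : ℕ, r.IsPositive (x⁻¹ * g ^ n) := by
  have hconj : ∀ x : G, ∀ n : ℕ,
      r.IsPositive ((g ^ n) ^ m * x) ↔ r.IsPositive (x * (g ^ n) ^ m) := fun x n => by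
    rw [← hm (g ^ n) (x * (g ^ n) ^ m)]
    simp [mul_assoc]
  have hgpow : ∀ n : ℕ, (g ^ n) ^ m = (g ^ m) ^ n := fun n => by rw [← pow_mul, ← pow_mul, mul_comm]
  have hmul : ∀ x y : G, ∀ M N : ℕ, r.IsPositive (x * (g ^ M) ^ m) →
      r.IsPositive (y * (g ^ N) ^ m) → r.IsPositive (x * y * (g ^ (M + N)) ^ m) := by
    intro x y M N hx hy
    rw [← hconj] at hx
    have := r.isPositive_mul hx hy
    rw [mul_assoc, hconj] at this
    convert this using 1
    rw [add_comm, pow_add, (Commute.pow_pow_self g N M).mul_pow]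
    simp [mul_assoc]
  -- The elements which, together with their inverses, lie below some power of `g`. Exponents are
  -- multiples of `m` so that `hconj` can move these powers past other factors.
  let D : Subgroup G :=
    { carrier := {x | ∃ M N : ℕ, r.IsPositive (x * (g ^ M) ^ m) ∧ r.IsPositive (x⁻¹ * (g ^ N) ^ m)}
      one_mem' := ⟨1, 1, by simpa using r.isPositive_pow hg hm0,
        by simpa using r.isPositive_pow hg hm0⟩
      mul_mem' := by
        rintro x y ⟨M, N, hx, hx'⟩ ⟨M', N', hy, hy'⟩
        exact ⟨M + M', N' + N, hmul _ _ _ _ hx hy, by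
          rw [mul_inv_rev]; exact hmul _ _ _ _ hy' hx'⟩
      inv_mem' := by
        rintro x ⟨M, N, hx, hx'⟩
        exact ⟨N, M, hx', by rwa [inv_inv]⟩ }
  -- The exponent `2 * m` is used because `g⁻¹ * g ^ m` is trivial when `m = 1`.
  refine ⟨D, ⟨1, 2, ?_, ?_⟩, ?_, ?_⟩
  · exact r.isPositive_mul hg (by simpa using r.isPositive_pow hg hm0)
  · rw [← pow_mul, ← zpow_natCast, ← zpow_neg_one, ← zpow_add]
    have : (-1 : ℤ) + ((2 * m : ℕ) : ℤ) = ((2 * m - 1 : ℕ) : ℤ) := by omega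
    rw [this, zpow_natCast]
    exact r.isPositive_pow hg (by omega)
  · rintro x - hx hP h ⟨M, N, hM, hN⟩
    by_contra hn
    have h1 := r.isPositive_inv_of_not
      (fun h' => hx (by rw [mul_eq_one_iff_eq_inv.mp h']; exact D.inv_mem ⟨M, N, hM, hN⟩)) hn
    refine hx ⟨1, M, ?_, ?_⟩
    · exact r.isPositive_mul hP (by simpa using r.isPositive_pow hg hm0)
    · rw [← hconj] at hM ⊢
      simpa [mul_assoc] using r.isPositive_mul hM h1
  · rintro x ⟨M, N, -, hN⟩
    exact ⟨N * m, by rwa [pow_mul]⟩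

/-- The convex hull of `g` is not contained in `K`, so it contains `H`. -/
theorem IsJump.archimedean {K H : Subgroup G} (hJ : r.IsJump K H) (hm0 : m ≠ 0)
    (hm : ∀ g x : G, r.IsPositive (g ^ m * x * (g ^ m)⁻¹) ↔ r.IsPositive x) {g x : G}
    (hg : g ∈ H) (hgK : g ∉ K) (hgP : r.IsPositive g) (hx : x ∈ H) :
    ∃ n : ℕ, r.IsPositive (x⁻¹ * g ^ n) := by
  obtain ⟨D, hgD, hD, hDn⟩ := exists_hull hm0 hm hgP
  apply hDn
  have hKD : K ≤ D := (hJ.convex_left.le_total hD).resolve_right fun h => hgK (h hgD)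
  rcases hD.le_total hJ.convex_right with h | h
  · rcases hJ.eq_or_eq D hD hKD h with rfl | rfl
    · exact absurd hgD hgK
    · exact hx
  · exact h hx

/-- If `y = z * x * z⁻¹` were a positive element outside `K`, its powers would be cofinal in `H`.
But `y ^ n * z = z * x ^ n` never leaves the coset `z K`, whose elements all have the sign of `z`.
-/
theorem IsJump.conj_mem {K H : Subgroup G} (hJ : r.IsJump K H) (hm0 : m ≠ 0)
    (hm : ∀ g x : G, r.IsPositive (g ^ m * x * (g ^ m)⁻¹) ↔ r.IsPositive x) {z x : G}
    (hz : z ∈ H) (hx : x ∈ K) : z * x * z⁻¹ ∈ K := by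
  by_contra hy
  have hyH : z * x * z⁻¹ ∈ H := H.mul_mem (H.mul_mem hz (hJ.lt.le hx)) (H.inv_mem hz)
  wlog hP : r.IsPositive (z * x * z⁻¹) generalizing x
  · have hinv : z * x⁻¹ * z⁻¹ = (z * x * z⁻¹)⁻¹ := by group
    refine this (K.inv_mem hx) ?_ ?_ ?_ <;> rw [hinv]
    · simpa only [K.inv_mem_iff] using hy
    · exact H.inv_mem hyH
    · exact r.isPositive_inv_of_not (fun h => hy (h ▸ K.one_mem)) hP
  have hzK : z ∉ K := fun h => hy (K.mul_mem (K.mul_mem h hx) (K.inv_mem h))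
  have hpow : ∀ n : ℕ, (z * x * z⁻¹) ^ n * z = z * x ^ n := fun n => by
    rw [conj_pow]
    group
  rcases (r.isPositive_or z).resolve_left (fun h => hzK (h ▸ K.one_mem)) with hzP | hzP
  · obtain ⟨n, hn⟩ := hJ.archimedean hm0 hm hyH hy hP (H.mul_mem hz hz)
    have h1 := r.isPositive_mul hn hzP
    rw [mul_assoc, hpow] at h1
    have h2 := hJ.convex_left.left le_top trivial hzK hzP (K.inv_mem (K.pow_mem hx n))
    refine r.not_isPositive_inv h1 ?_
    convert h2 using 1
    group
  · obtain ⟨n, hn⟩ := hJ.archimedean hm0 hm hyH hy hP (H.inv_mem hz)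
    rw [inv_inv] at hn
    -- Raising the exponent to a multiple of `m` allows the power to be moved to the left of `z`.
    have h1 : r.IsPositive (z * ((z * x * z⁻¹) ^ n) ^ m) := by
      obtain ⟨k, rfl⟩ := Nat.exists_eq_succ_of_ne_zero hm0
      rw [pow_succ', ← mul_assoc]
      rcases eq_or_ne (n * k) 0 with h | h
      · rwa [← pow_mul, h, pow_zero, mul_one]
      · rw [← pow_mul]
        exact r.isPositive_mul hn (r.isPositive_pow hP h)
    rw [← hm ((z * x * z⁻¹) ^ n), ← mul_assoc, mul_inv_cancel_right, ← pow_mul, hpow] at h1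
    have hxK := K.pow_mem hx (n * m)
    have h2 := hJ.convex_left _ trivial (fun h => hzK ((K.mul_mem_cancel_right hxK).mp h)) h1 _
      (K.inv_mem hxK)
    rw [mul_inv_cancel_right] at h2
    exact r.not_isPositive_inv h2 hzP

theorem IsJump.exists_real {K H : Subgroup G} (hJ : r.IsJump K H) (hm0 : m ≠ 0)
    (hm : ∀ g x : G, r.IsPositive (g ^ m * x * (g ^ m)⁻¹) ↔ r.IsPositive x) :
    ∃ φ : G → ℝ, (∀ x ∈ H, ∀ y ∈ H, φ (x * y) = φ x + φ y) ∧ ∀ x ∈ H, φ x = 0 ↔ x ∈ K := by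
  classical
  have hn : (K.subgroupOf H).Normal := ⟨fun x hx g => by
    rw [Subgroup.mem_subgroupOf] at hx ⊢
    exact hJ.conj_mem hm0 hm g.2 hx⟩
  let P : H ⧸ K.subgroupOf H → Prop := fun a =>
    ∃ x : H, QuotientGroup.mk x = a ∧ (x : G) ∉ K ∧ r.IsPositive x
  have hmk : ∀ x : H, P (QuotientGroup.mk x) → (x : G) ∉ K ∧ r.IsPositive x := by
    rintro x ⟨y, hy, hyK, hyP⟩
    rw [QuotientGroup.eq, Subgroup.mem_subgroupOf] at hy
    have hxy : (x : G) = y * (y⁻¹ * x : H) := by simp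
    rw [hxy]
    exact ⟨fun h => hyK ((K.mul_mem_cancel_right hy).mp h),
      hJ.convex_left _ trivial hyK hyP _ hy⟩
  have h1 : ¬ P 1 := fun h => (hmk 1 h).1 K.one_mem
  have hmul : ∀ a b, P a → P b → P (a * b) := by
    rintro _ _ ⟨x, rfl, hx, hx'⟩ ⟨y, rfl, hy, hy'⟩
    refine ⟨x * y, rfl, fun hxy => ?_, r.isPositive_mul hx' hy'⟩
    have := hJ.convex_left y trivial hy hy' _ (K.inv_mem hxy)
    exact absurd (by simpa using this) (r.not_isPositive_inv hx')
  have htot : ∀ a, a ≠ 1 → P a ∨ P a⁻¹ := by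
    intro a ha
    induction a using QuotientGroup.induction_on with
    | H x =>
      rw [Ne, QuotientGroup.eq_one_iff, Subgroup.mem_subgroupOf] at ha
      rcases (r.isPositive_or (x : G)).resolve_left (fun h => ha (h ▸ K.one_mem)) with h | h
      · exact Or.inl ⟨x, rfl, ha, h⟩
      · exact Or.inr ⟨x⁻¹, rfl, by simpa using ha, h⟩
  obtain ⟨φ, hφ, hφ'⟩ := exists_real_embedding (r := ofCone P h1 hmul htot) (by
    simp only [ofCone_isPositive]
    intro a b ha
    induction a using QuotientGroup.induction_on with
    | H g =>
    induction b using QuotientGroup.induction_on with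
    | H x =>
      obtain ⟨hg, hgP⟩ := hmk g ha
      obtain ⟨n, hn⟩ := hJ.archimedean hm0 hm g.2 hg hgP x.2
      -- If the difference lies in `K`, it vanishes in the quotient; one more factor `g` restores
      -- strictness.
      by_cases hK : (x : G)⁻¹ * g ^ n ∈ K
      · refine ⟨n + 1, x⁻¹ * g ^ (n + 1), rfl, ?_, ?_⟩
        · push_cast
          rw [pow_succ, ← mul_assoc]
          exact fun h => hg ((K.mul_mem_cancel_left hK).mp h)
        · push_cast
          rw [pow_succ, ← mul_assoc]
          exact r.isPositive_mul hn hgP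
      · exact ⟨n, x⁻¹ * g ^ n, rfl, by simpa using hK, by simpa using hn⟩)
  refine ⟨fun x => if hx : x ∈ H then φ (QuotientGroup.mk ⟨x, hx⟩) else 0, ?_, ?_⟩
  · intro x hx y hy
    simp only [hx, hy, H.mul_mem hx hy, dif_pos]
    rw [← hφ, ← QuotientGroup.mk_mul]
    rfl
  · intro x hx
    simp only [hx, dif_pos]
    rw [hφ', QuotientGroup.eq_one_iff, Subgroup.mem_subgroupOf]

end

/-- Jumps are rational if there are only finitely many left orders. -/
theorem IsJump.exists_isQuot [Finite (LeftOrder G)] {r : LeftOrder G} {K H : Subgroup G}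
    (hJ : r.IsJump K H) : ∃ φ, IsQuot K H φ := by
  obtain ⟨m, hm0, hm⟩ := exists_pow_conj_isPositive G
  obtain ⟨φ, hφ, hφK⟩ := hJ.exists_real hm0 (hm r)
  obtain ⟨g, hg, hgK⟩ := SetLike.exists_of_lt hJ.lt
  rw [← hφK g hg] at hgK
  -- All composites of `φ` with `ℚ`-linear functionals are proportional on `H`, so one that is
  -- nonzero at `g` already has the kernel of `φ`.
  have hom : ∀ f : ℝ →ₗ[ℚ] ℚ, IsHomOn H (fun x => f (φ x)) := fun f x hx y hy => by
    simp only [hφ x hx y hy, _root_.map_add]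
  obtain ⟨f, hf⟩ : ∃ f : ℝ →ₗ[ℚ] ℚ, f (φ g) ≠ 0 := by
    by_contra! h
    exact hgK ((Module.forall_dual_apply_eq_zero_iff ℚ _).mp h)
  refine ⟨fun x => f (φ x), hJ.lt.le, hom f, fun x hx => ⟨fun h => ?_, fun h => ?_⟩⟩
  · rw [← hφK x hx, ← Module.forall_dual_apply_eq_zero_iff ℚ]
    intro f'
    have := hJ.convex_right.hom_dependent (hom f') (hom f) hx hg
    simp only [h, mul_zero] at this
    exact (mul_eq_zero.mp this).resolve_right hf
  · simp only [(hφK x hx).mpr h, _root_.map_zero]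

/-- The convex subgroups of a left order on a group with finitely many left orders form a rational
series. -/
theorem exists_rationalSeries [Finite (LeftOrder G)] (r : LeftOrder G) :
    ∃ S : RationalSeries G, ∀ k, r.ConvexIn (S.term k) ⊤ := by
  classical
  let X := {H : Subgroup G // r.ConvexIn H ⊤}
  have hX : Finite X := r.finite_convex
  let : LinearOrder X :=
    { (inferInstance : PartialOrder X) with
      le_total := fun H K => H.2.le_total K.2
      toDecidableLE := Classical.decRel _ }
  let topX : X := ⟨⊤, fun x _ hx => absurd trivial hx⟩
  let botX : X := ⟨⊥, fun x _ _ hP h hh => by rw [Subgroup.mem_bot] at hh; rwa [hh, mul_one]⟩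
  let : Fintype Xᵒᵈ := Fintype.ofFinite _
  have hne : Nonempty Xᵒᵈ := ⟨OrderDual.toDual topX⟩
  obtain ⟨n, hn⟩ := Nat.exists_eq_succ_of_ne_zero (Fintype.card_ne_zero (α := Xᵒᵈ))
  let e : Fin (n + 1) ≃o Xᵒᵈ := Fintype.orderIsoFinOfCardEq Xᵒᵈ hn
  have hlt : ∀ i j, i < j → (OrderDual.ofDual (e j)).1 < (OrderDual.ofDual (e i)).1 :=
    fun i j hij => e.strictMono hij
  have hjump : ∀ i : Fin n, r.IsJump (OrderDual.ofDual (e i.succ)).1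
      (OrderDual.ofDual (e i.castSucc)).1 := fun i =>
    { lt := hlt _ _ i.castSucc_lt_succ
      convex_left := (OrderDual.ofDual (e i.succ)).2
      convex_right := (OrderDual.ofDual (e i.castSucc)).2
      eq_or_eq := fun L hL h1 h2 => by
        obtain ⟨j, hj⟩ := e.surjective (OrderDual.toDual ⟨L, hL⟩)
        have hjL : (OrderDual.ofDual (e j)).1 = L := by rw [hj]; rfl
        subst hjL
        have h1' : j ≤ i.succ := e.le_iff_le.mp h1
        have h2' : i.castSucc ≤ j := e.le_iff_le.mp h2
        rcases h2'.eq_or_lt with h | h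
        · exact Or.inr (by rw [h])
        · exact Or.inl (by rw [le_antisymm h1' (Fin.castSucc_lt_iff_succ_le.mp h)]) }
  refine ⟨⟨n, fun i => (OrderDual.ofDual (e i)).1, ?_, ?_, fun i => (hjump i).lt, fun i => ?_⟩,
    fun k => (OrderDual.ofDual (e k)).2⟩
  · obtain ⟨j, hj⟩ := e.surjective (OrderDual.toDual topX)
    have h1 : (e 0 : Xᵒᵈ) ≤ e j := e.monotone (Fin.zero_le j)
    rw [hj] at h1
    exact top_le_iff.mp h1
  · obtain ⟨j, hj⟩ := e.surjective (OrderDual.toDual botX)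
    have h1 : (e j : Xᵒᵈ) ≤ e (Fin.last n) := e.monotone (Fin.le_last j)
    rw [hj] at h1
    exact le_bot_iff.mp h1
  · obtain ⟨φ, hφ⟩ := (hjump i).exists_isQuot
    exact ⟨hφ.normal, by have := hφ.normal; exact hφ.isRationalGroup⟩

end LeftOrder

/-! ### Conjugation on consecutive rational quotients -/

/-- The factor by which conjugation acts on a rational quotient, computed at `a`. -/
def conjFactor (ψ : G → ℚ) (a g : G) : ℚ := ψ (g * a * g⁻¹) / ψ a

section

variable {r : LeftOrder G} {H K L : Subgroup G} {φ ψ : G → ℚ} {a : G}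

/-- Both `ψ` and its composite with conjugation by `g` are homomorphisms from `K` to `ℚ`, hence
proportional. -/
theorem map_conj_eq_conjFactor_mul [Finite (LeftOrder G)] (hK : r.ConvexIn K ⊤)
    (hφ : IsQuot K H φ) (hψ : IsQuot L K ψ) (ha : a ∈ K) (ha0 : ψ a ≠ 0) {g x : G} (hg : g ∈ H)
    (hx : x ∈ K) : ψ (g * x * g⁻¹) = conjFactor ψ a g * ψ x := by
  have hom : IsHomOn K (fun x => ψ (g * x * g⁻¹)) := fun x hx y hy => by
    rw [← hψ.hom _ (hφ.conj_mem hg hx) _ (hφ.conj_mem hg hy)]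
    group
  have := hK.hom_dependent hom hψ.hom hx ha
  rw [conjFactor]
  field_simp
  linarith

theorem conjFactor_ne_zero [Finite (LeftOrder G)] (hK : r.ConvexIn K ⊤)
    (hφ : IsQuot K H φ) (hψ : IsQuot L K ψ) (ha : a ∈ K) (ha0 : ψ a ≠ 0) {g : G} (hg : g ∈ H) :
    conjFactor ψ a g ≠ 0 := by
  intro h
  have hx := hφ.conj_mem (H.inv_mem hg) ha
  have h1 := map_conj_eq_conjFactor_mul hK hφ hψ ha ha0 hg hx
  rw [h, zero_mul] at h1
  apply ha0
  rw [← h1]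
  congr 1
  group

theorem conjFactor_mul [Finite (LeftOrder G)] (hK : r.ConvexIn K ⊤)
    (hφ : IsQuot K H φ) (hψ : IsQuot L K ψ) (ha : a ∈ K) (ha0 : ψ a ≠ 0) {g h : G} (hg : g ∈ H)
    (hh : h ∈ H) : conjFactor ψ a (g * h) = conjFactor ψ a g * conjFactor ψ a h := by
  have h1 := map_conj_eq_conjFactor_mul hK hφ hψ ha ha0 hg (hφ.conj_mem hh ha)
  have h2 := map_conj_eq_conjFactor_mul hK hφ hψ ha ha0 hh ha
  have h3 := map_conj_eq_conjFactor_mul hK hφ hψ ha ha0 (H.mul_mem hg hh) ha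
  have : g * (h * a * h⁻¹) * g⁻¹ = g * h * a * (g * h)⁻¹ := by group
  rw [this, h3, h2, ← mul_assoc] at h1
  exact mul_right_cancel₀ ha0 h1

theorem conjFactor_eq_one (hψ : IsHomOn K ψ) (ha : a ∈ K) (ha0 : ψ a ≠ 0) {g : G} (hg : g ∈ K) :
    conjFactor ψ a g = 1 := by
  rw [conjFactor, hψ.map_conj hg ha, div_self ha0]

theorem normal_subgroupOf_of_finite [Finite (LeftOrder G)] (hK : r.ConvexIn K ⊤)
    (hφ : IsQuot K H φ) (hψ : IsQuot L K ψ) (ha : a ∈ K) (ha0 : ψ a ≠ 0) :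
    (L.subgroupOf H).Normal := by
  refine ⟨fun x hx g => ?_⟩
  rw [Subgroup.mem_subgroupOf] at hx ⊢
  refine (hψ.ker _ (hφ.conj_mem g.2 (hψ.le hx))).mp ?_
  rw [map_conj_eq_conjFactor_mul hK hφ hψ ha ha0 g.2 (hψ.le hx), (hψ.ker _ (hψ.le hx)).mpr hx,
    mul_zero]

/-- Bi-orderability of `H / L` forces conjugation to act by positive factors. -/
theorem conjFactor_pos [Finite (LeftOrder G)] (hK : r.ConvexIn K ⊤)
    (hφ : IsQuot K H φ) (hψ : IsQuot L K ψ) (ha : a ∈ K) (ha0 : ψ a ≠ 0)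
    [hn : (L.subgroupOf H).Normal] (hbi : IsBiOrderable (H ⧸ L.subgroupOf H)) {g : G}
    (hg : g ∈ H) : 0 < conjFactor ψ a g := by
  by_contra hneg
  have hq : conjFactor ψ a g < 0 :=
    lt_of_le_of_ne (not_lt.mp hneg) (conjFactor_ne_zero hK hφ hψ ha ha0 hg)
  set q := conjFactor ψ a g with hqdef
  obtain ⟨ρ, hρ⟩ := hbi
  have hnum : q.num < 0 := Rat.num_neg.mpr hq
  have haH := hφ.le ha
  -- Writing `q = -v / d`, the product of a conjugate of `a ^ d` with `a ^ v` dies in `H / L`,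
  -- although both factors have the same sign in a bi-order.
  have hmem : g * a ^ q.den * g⁻¹ * a ^ q.num.natAbs ∈ L := by
    have h1 := hφ.conj_mem hg (K.pow_mem ha q.den)
    rw [← hψ.ker _ (K.mul_mem h1 (K.pow_mem ha _)), hψ.hom _ h1 _ (K.pow_mem ha _),
      map_conj_eq_conjFactor_mul hK hφ hψ ha ha0 hg (K.pow_mem ha _), hψ.hom.map_pow ha,
      hψ.hom.map_pow ha, ← hqdef]
    have h2 : (q.num.natAbs : ℚ) = -q.num := by
      rw [← Int.cast_neg, ← abs_of_neg hnum, Int.abs_eq_natAbs, Int.cast_natCast]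
    have h3 : q * q.den = q.num := Rat.mul_den_eq_num q
    rw [h2]
    linear_combination ψ a * h3
  let a' : H := ⟨a, haH⟩
  let g' : H := ⟨g, hg⟩
  let A : H ⧸ L.subgroupOf H := QuotientGroup.mk a'
  let B : H ⧸ L.subgroupOf H := QuotientGroup.mk g'
  have hAB : B * A ^ q.den * B⁻¹ * A ^ q.num.natAbs = 1 := by
    have h1 : (QuotientGroup.mk (g' * a' ^ q.den * g'⁻¹ * a' ^ q.num.natAbs) :
        H ⧸ L.subgroupOf H) = 1 :=
      (QuotientGroup.eq_one_iff _).mpr (Subgroup.mem_subgroupOf.mpr hmem)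
    simpa [A, B] using h1
  have hA1 : A ≠ 1 := fun h => by
    rw [QuotientGroup.eq_one_iff, Subgroup.mem_subgroupOf] at h
    exact ha0 ((hψ.ker a ha).mpr h)
  have hconj : ∀ x y, ρ.IsPositive x → ρ.IsPositive (y * x * y⁻¹) := fun x y hx => by
    have := hρ _ _ y⁻¹ (ρ.mul_left _ _ y hx)
    simpa [LeftOrder.IsPositive] using this
  have hd := q.den_nz
  have hv : q.num.natAbs ≠ 0 := by omega
  rcases (ρ.isPositive_or A).resolve_left hA1 with h | h
  · have := ρ.isPositive_mul (hconj _ B (ρ.isPositive_pow h hd)) (ρ.isPositive_pow h hv)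
    rw [hAB] at this
    exact ρ.not_isPositive_one this
  · have := ρ.isPositive_mul (ρ.isPositive_pow h hv) (hconj _ B (ρ.isPositive_pow h hd))
    have heq : A⁻¹ ^ q.num.natAbs * (B * A⁻¹ ^ q.den * B⁻¹) =
        (B * A ^ q.den * B⁻¹ * A ^ q.num.natAbs)⁻¹ := by
      simp [mul_assoc]
    rw [heq, hAB, inv_one] at this
    exact ρ.not_isPositive_one this

end

/-- Homomorphisms to `ℚ` extend along inclusions in abelian quotients. -/
theorem IsQuot.exists_extension {H K L : Subgroup G} {ψ : G → ℚ} (hψ : IsQuot L K ψ) (hKH : K ≤ H)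
    (hcomm : ∀ x ∈ H, ∀ y ∈ H, x * y * x⁻¹ * y⁻¹ ∈ L) :
    ∃ Ψ : G → ℚ, IsHomOn H Ψ ∧ ∀ x ∈ K, Ψ x = ψ x := by
  classical
  have hn : (L.subgroupOf H).Normal := ⟨fun x hx g => by
    rw [Subgroup.mem_subgroupOf] at hx ⊢
    have := L.mul_mem (hcomm g g.2 x x.2) hx
    simpa using this⟩
  let Q := H ⧸ L.subgroupOf H
  let : CommGroup Q := { (inferInstance : Group Q) with
    mul_comm := fun a b => by
      induction a using QuotientGroup.induction_on with
      | H x =>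
      induction b using QuotientGroup.induction_on with
      | H y =>
        refine QuotientGroup.eq.mpr (Subgroup.mem_subgroupOf.mpr ?_)
        have := hcomm (y⁻¹ : H) (y⁻¹ : H).2 (x⁻¹ : H) (x⁻¹ : H).2
        simpa [mul_assoc] using this }
  let π : H → Q := fun x => QuotientGroup.mk x
  have hπ : ∀ x y : H, π x = π y → (x : G) ∈ K → (y : G) ∈ K → ψ x = ψ y := by
    intro x y hxy hx hy
    have h1 := Subgroup.mem_subgroupOf.mp (QuotientGroup.eq.mp hxy)
    push_cast at h1
    rw [← hψ.ker _ (K.mul_mem (K.inv_mem hx) hy), hψ.hom _ (K.inv_mem hx) _ hy,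
      hψ.hom.map_inv hx] at h1
    linarith
  let M : Subgroup Q := (K.subgroupOf H).map (QuotientGroup.mk' (L.subgroupOf H))
  have hM : ∀ z : M, ∃ x : H, (x : G) ∈ K ∧ π x = z := by
    rintro ⟨_, x, hx, rfl⟩
    exact ⟨x, hx, rfl⟩
  choose lift hlift hlift' using hM
  let f : Additive M →+ ℚ := AddMonoidHom.mk' (fun z => ψ (lift z.toMul)) (fun z w => by
    rw [← hψ.hom _ (hlift _) _ (hlift _)]
    refine hπ (lift _) (lift _ * lift _) ?_ (hlift _) (K.mul_mem (hlift _) (hlift _))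
    have : π (lift z.toMul * lift w.toMul) = π (lift z.toMul) * π (lift w.toMul) := rfl
    rw [this, hlift', hlift', hlift']
    rfl)
  -- `ℚ` is divisible, hence injective.
  obtain ⟨F, hF⟩ := (Module.Baer.of_divisible ℚ).extension_property_addMonoidHom
    (MonoidHom.toAdditive M.subtype) (fun z w h => M.subtype_injective h) f
  refine ⟨fun x => if hx : x ∈ H then F (Additive.ofMul (π ⟨x, hx⟩)) else 0, ?_, ?_⟩
  · intro x hx y hy
    simp only [hx, hy, H.mul_mem hx hy, dif_pos]
    rw [← _root_.map_add]
    rfl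
  · intro x hx
    simp only [hKH hx, dif_pos]
    let z : M := ⟨π ⟨x, hKH hx⟩, ⟨x, hKH hx⟩, hx, rfl⟩
    have := DFunLike.congr_fun hF (Additive.ofMul z)
    have h2 : F (Additive.ofMul (π ⟨x, hKH hx⟩)) = ψ (lift z) := this
    rw [h2]
    exact hπ (lift z) ⟨x, hKH hx⟩ (hlift' z) (hlift z) hx

section

variable {r : LeftOrder G} {H K L : Subgroup G} {φ ψ : G → ℚ} {a : G}

/-- Conjugation cannot act trivially on the lower of two consecutive quotients. -/
theorem exists_conjFactor_ne_one [Finite (LeftOrder G)] (hH : r.ConvexIn H ⊤)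
    (hK : r.ConvexIn K ⊤) (hφ : IsQuot K H φ) (hψ : IsQuot L K ψ) {b : G} (hb : b ∈ H)
    (hb0 : φ b ≠ 0) (ha : a ∈ K) (ha0 : ψ a ≠ 0) : ∃ g ∈ H, conjFactor ψ a g ≠ 1 := by
  by_contra! hone
  have hconj : ∀ g ∈ H, ∀ x ∈ K, ψ (g * x * g⁻¹) = ψ x := fun g hg x hx => by
    rw [map_conj_eq_conjFactor_mul hK hφ hψ ha ha0 hg hx, hone g hg, one_mul]
  have hcK : ∀ x ∈ H, ∀ y ∈ H, x * y * x⁻¹ * y⁻¹ ∈ K := fun x hx y hy => by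
    have h1 := H.mul_mem (H.mul_mem hx hy) (H.inv_mem hx)
    rw [← hφ.ker _ (H.mul_mem h1 (H.inv_mem hy)), hφ.hom _ h1 _ (H.inv_mem hy),
      hφ.hom.map_conj hx hy, hφ.hom.map_inv hy, add_neg_cancel]
  have hc : ∀ x ∈ H, ∀ y ∈ H, x * y * x⁻¹ * y⁻¹ ∈ L := by
    intro x hx y hy
    rw [← hψ.ker _ (hcK x hx y hy)]
    by_cases hyK : y ∈ K
    · rw [hψ.hom _ (hφ.conj_mem hx hyK) _ (K.inv_mem hyK), hconj x hx y hyK, hψ.hom.map_inv hyK,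
        add_neg_cancel]
    -- The action being trivial, the commutator with `y` is a homomorphism in `x`. It is
    -- proportional to `φ` and vanishes at `y`, where `φ` does not, so it is zero.
    · have hom : IsHomOn H (fun x => ψ (x * y * x⁻¹ * y⁻¹)) := by
        intro x hx x' hx'
        have : x * x' * y * (x * x')⁻¹ * y⁻¹ =
            x * (x' * y * x'⁻¹ * y⁻¹) * x⁻¹ * (x * y * x⁻¹ * y⁻¹) := by group
        simp only [this]
        rw [hψ.hom _ (hφ.conj_mem hx (hcK x' hx' y hy)) _ (hcK x hx y hy),
          hconj x hx _ (hcK x' hx' y hy), add_comm]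
      have := hH.hom_dependent hom hφ.hom hx hy
      simp only [mul_inv_cancel_right, mul_inv_cancel, hψ.hom.map_one, zero_mul] at this
      exact (mul_eq_zero.mp this).resolve_right fun h => hyK ((hφ.ker y hy).mp h)
  -- The extension is nonzero at `a`, where `φ` vanishes, contradicting proportionality.
  obtain ⟨Ψ, hΨ, hΨψ⟩ := hψ.exists_extension hφ.le hc
  have := hH.hom_dependent hΨ hφ.hom (hφ.le ha) hb
  rw [(hφ.ker a (hφ.le ha)).mpr ha, mul_zero, hΨψ a ha] at this
  exact mul_ne_zero ha0 hb0 this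

/-- If conjugation acts by positive factors, not all equal to `1`, then `H / L` acts on the
rational line by affine maps, and this gives infinitely many left orders. -/
theorem conjFactor_eq_one_of_pos [Finite (LeftOrder G)] (hH : r.ConvexIn H ⊤)
    (hK : r.ConvexIn K ⊤) (hφ : IsQuot K H φ) (hψ : IsQuot L K ψ) (ha : a ∈ K) (ha0 : ψ a ≠ 0)
    (hpos : ∀ g ∈ H, 0 < conjFactor ψ a g) {g : G} (hg : g ∈ H) : conjFactor ψ a g = 1 := by
  by_contra hne
  obtain ⟨m, hm0, hm⟩ := LeftOrder.exists_pow_conj_isPositive G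
  have hconj : ∀ g ∈ H, ∀ x ∈ K, ψ (g * x * g⁻¹) = conjFactor ψ a g * ψ x := fun g hg x hx =>
    map_conj_eq_conjFactor_mul hK hφ hψ ha ha0 hg hx
  have hqmul : ∀ g ∈ H, ∀ h ∈ H, conjFactor ψ a (g * h) = conjFactor ψ a g * conjFactor ψ a h :=
    fun g hg h hh => conjFactor_mul hK hφ hψ ha ha0 hg hh
  have hqK : ∀ x ∈ K, conjFactor ψ a x = 1 := fun x hx => conjFactor_eq_one hψ.hom ha ha0 hx
  generalize conjFactor ψ a = q at *
  have hq1 : 1 - q g ≠ 0 := sub_ne_zero.mpr (Ne.symm hne)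
  have hcK : ∀ x ∈ H, x * g * x⁻¹ * g⁻¹ ∈ K := fun x hx => by
    have h1 := H.mul_mem (H.mul_mem hx hg) (H.inv_mem hx)
    rw [← hφ.ker _ (H.mul_mem h1 (H.inv_mem hg)), hφ.hom _ h1 _ (H.inv_mem hg),
      hφ.hom.map_conj hx hg, hφ.hom.map_inv hg, add_neg_cancel]
  -- In the affine action, `K` translates by `ψ` and `g` fixes `0`; `F x` is the displacement of the
  -- base point `t`. The conjugate of `g` by `a⁻¹ ^ m` fixes `-(m * ψ a)`, and `t` is the midpoint
  -- of the two fixed points. So `g` and this conjugate displace `t` oppositely, although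
  -- conjugation by an `m`-th power preserves signs.
  let t : ℚ := -(m * ψ a / 2)
  let F : G → ℚ := fun x => (q x - 1) * t + ψ (x * g * x⁻¹ * g⁻¹) / (1 - q g)
  have hF : ∀ x ∈ H, ∀ y ∈ H, F (x * y) = F x + q x * F y := by
    intro x hx y hy
    have h1 : x * y * g * (x * y)⁻¹ * g⁻¹ =
        x * (y * g * y⁻¹ * g⁻¹) * x⁻¹ * (x * g * x⁻¹ * g⁻¹) := by group
    simp only [F, h1, hqmul x hx y hy]
    rw [hψ.hom _ (hφ.conj_mem hx (hcK y hy)) _ (hcK x hx), hconj x hx _ (hcK y hy)]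
    ring
  have hFK : ∀ x ∈ K, F x = ψ x := by
    intro x hx
    have h1 : x * g * x⁻¹ * g⁻¹ = x * (g * x⁻¹ * g⁻¹) := by group
    have h2 := hφ.conj_mem hg (K.inv_mem hx)
    simp only [F, h1, hqK x hx]
    rw [hψ.hom _ hx _ h2, hconj g hg _ (K.inv_mem hx), hψ.hom.map_inv hx]
    field_simp
    ring
  have hFg : F g = (q g - 1) * t := by
    simp only [F, mul_inv_cancel_right, mul_inv_cancel, hψ.hom.map_one, zero_div, add_zero]
  have ham := K.pow_mem ha m
  have hy : a⁻¹ ^ m * g * (a⁻¹ ^ m)⁻¹ ∈ H :=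
    H.mul_mem (H.mul_mem (H.pow_mem (H.inv_mem (hφ.le ha)) m) hg)
      (H.inv_mem (H.pow_mem (H.inv_mem (hφ.le ha)) m))
  have hFy : F (a⁻¹ ^ m * g * (a⁻¹ ^ m)⁻¹) = - F g := by
    rw [inv_pow, inv_inv, hF _ (H.mul_mem (H.inv_mem (hφ.le ham)) hg) _ (hφ.le ham),
      hF _ (H.inv_mem (hφ.le ham)) _ hg, hqmul _ (H.inv_mem (hφ.le ham)) _ hg,
      hqK _ (K.inv_mem ham), hFK _ (K.inv_mem ham), hFK _ ham, hψ.hom.map_inv ham,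
      hψ.hom.map_pow ha, hFg]
    simp only [t]
    ring
  obtain ⟨s, hs⟩ := hH.exists_modify hpos hF
  have hs' : ∀ x ∈ H, F x < 0 → s.IsPositive x⁻¹ := by
    intro x hx hFx
    refine hs _ (H.inv_mem hx) ?_
    have h1 := hF x hx _ (H.inv_mem hx)
    rw [mul_inv_cancel, hFK 1 K.one_mem, hψ.hom.map_one] at h1
    exact pos_of_mul_pos_right (by linarith) (hpos x hx).le
  have hF0 : F g ≠ 0 := by
    rw [hFg]
    refine mul_ne_zero (sub_ne_zero.mpr hne) ?_
    simp [t, hm0, ha0]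
  rcases hF0.lt_or_gt with h | h
  · have h1 := hs _ hy (by rw [hFy]; linarith)
    rw [hm] at h1
    exact s.not_isPositive_inv h1 (hs' g hg h)
  · have h1 := hs' _ hy (by rw [hFy]; linarith)
    have h2 := hs g hg h
    rw [← hm s a⁻¹] at h2
    exact s.not_isPositive_inv h2 h1

end

/-! ### Properties of the series in the finite case -/

namespace RationalSeries

theorem nonBiOrderableQuotients_of_finite [Finite (LeftOrder G)] {r : LeftOrder G}
    (S : RationalSeries G) (hS : ∀ k, r.ConvexIn (S.term k) ⊤) : S.NonBiOrderableQuotients := by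
  obtain ⟨φ, hφ⟩ := S.exists_isQuot
  rintro ⟨i, hi⟩ ⟨j, hj⟩ (rfl : j = i + 2)
  let i₁ : Fin S.length := ⟨i, by omega⟩
  let i₂ : Fin S.length := ⟨i + 1, by omega⟩
  have h1 : IsQuot (S.term i₁.succ) (S.term ⟨i, hi⟩) (φ i₁) := hφ i₁
  have h2 : IsQuot (S.term ⟨i + 2, hj⟩) (S.term i₁.succ) (φ i₂) := hφ i₂
  obtain ⟨a, ha, haL⟩ := SetLike.exists_of_lt (S.strict i₂)
  obtain ⟨b, hb, hbK⟩ := SetLike.exists_of_lt (S.strict i₁)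
  have ha0 : φ i₂ a ≠ 0 := fun h => haL ((h2.ker a ha).mp h)
  have hb0 : φ i₁ b ≠ 0 := fun h => hbK ((h1.ker b hb).mp h)
  have hn := normal_subgroupOf_of_finite (hS i₁.succ) h1 h2 ha ha0
  refine ⟨hn, fun hbi => ?_⟩
  obtain ⟨g, hg, hg1⟩ := exists_conjFactor_ne_one (hS _) (hS _) h1 h2 hb hb0 ha ha0
  exact hg1 (conjFactor_eq_one_of_pos (hS _) (hS _) h1 h2 ha ha0
    (fun g hg => conjFactor_pos (hS _) h1 h2 ha ha0 hbi hg) hg)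

/-- An automorphism carries the convex subgroups of `r` to those of the image order, which are the
same chain. The induced map on indices is strictly increasing, hence the identity. -/
theorem characteristic_of_isMaximalConvexSequence (S : RationalSeries G)
    (hS : ∀ r : LeftOrder G, r.IsMaximalConvexSequence S.term) (r : LeftOrder G)
    (k : Fin (S.length + 1)) : (S.term k).Characteristic := by
  rw [Subgroup.characteristic_iff_map_eq]
  intro e
  have hconv : ∀ i, ∃ j, S.term j = (S.term i).map e.toMonoidHom := fun i => by
    rw [← (hS ((show MulAut G from e) • r)).2.2.2, LeftOrder.isConvex_iff]
    exact ((r.isConvex_iff _).mp (((hS r).2.2.2 _).mpr ⟨i, rfl⟩)).smul _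
  choose σ hσ using hconv
  have hmono : StrictMono σ := fun i j hij => by
    rw [← S.strictAnti.lt_iff_gt, hσ, hσ]
    exact (Subgroup.map_lt_map_iff_of_injective e.injective).mpr (S.strictAnti hij)
  have hid : σ = id := (hmono.range_inj strictMono_id).mp (by
    rw [(Finite.injective_iff_surjective.mp hmono.injective).range_eq, Set.range_id])
  rw [← hσ, hid, id]

theorem eq_of_isMaximalConvexSequence {S T : RationalSeries G} {r : LeftOrder G}
    (hS : r.IsMaximalConvexSequence S.term) (hT : r.IsMaximalConvexSequence T.term) : T = S := by
  obtain ⟨n, s, _, _, _, _⟩ := S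
  obtain ⟨n', s', _, _, _, _⟩ := T
  obtain rfl : n' = n := hT.length_eq hS
  obtain rfl : s' = s := hT.unique hS
  rfl

end RationalSeries

end Tararin

theorem theorem6p2 (G : Type*) [Group G] [Countable G] :
    -- groups with finitely many left orders
    (Nonempty (Tararin.LeftOrder G) → Finite (Tararin.LeftOrder G) →
      ∃ S : Tararin.RationalSeries G,
        -- `S` is the unique rational series, and its terms are characteristic, hence normal
        (∀ T : Tararin.RationalSeries G, T = S) ∧
        (∀ i, (S.term i).Characteristic ∧ (S.term i).Normal) ∧
        -- the left orders are parametrized by signs on the elements `s i`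
        (∃ s : Fin S.length → G,
          (∀ i, s i ∈ S.term i.castSucc ∧ s i ∉ S.term i.succ) ∧
          ∃ Λ : (Fin S.length → ℤˣ) → Tararin.LeftOrder G,
            (∀ ε, (∀ i, (Λ ε).IsPositive (s i ^ ((ε i : ℤˣ) : ℤ))) ∧
              ∀ r : Tararin.LeftOrder G,
                (∀ i, r.IsPositive (s i ^ ((ε i : ℤˣ) : ℤ))) → r = Λ ε) ∧
            Set.range Λ = Set.univ) ∧
        Nat.card (Tararin.LeftOrder G) = 2 ^ S.length ∧
        -- `S` is the maximal convex sequence of every left order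
        (∀ r : Tararin.LeftOrder G, r.IsMaximalConvexSequence S.term) ∧
        -- the quotients of terms two steps apart are not bi-orderable
        S.NonBiOrderableQuotients) ∧
    -- the converse
    (∀ S : Tararin.RationalSeries G, S.NonBiOrderableQuotients →
      Nat.card (Tararin.LeftOrder G) = 2 ^ S.length) := by
  refine ⟨?_, fun S hS => (S.exists_parametrization hS.convexIn).2⟩
  rintro ⟨r⟩ hfin
  obtain ⟨S, hS⟩ := r.exists_rationalSeries
  have hnb := S.nonBiOrderableQuotients_of_finite hS
  obtain ⟨hs, hcard⟩ := S.exists_parametrization hnb.convexIn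
  -- `hnb` was obtained from one order but does not mention it, so convexity passes to all orders.
  have hmax : ∀ r : Tararin.LeftOrder G, r.IsMaximalConvexSequence S.term := fun r =>
    S.isMaximalConvexSequence (S.convexIn_top (hnb.convexIn r))
  refine ⟨S, fun T => ?_, fun i => ?_, hs, hcard, hmax, hnb⟩
  · obtain ⟨φ, hφ⟩ := T.exists_isQuot
    -- Any rational series is the maximal convex sequence of its own lexicographic order, hence
    -- equals `S`.
    obtain ⟨ρ, hρ, -⟩ := T.exists_lex hφ 1
    exact Tararin.RationalSeries.eq_of_isMaximalConvexSequence (hmax ρ)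
      (T.isMaximalConvexSequence hρ)
  · have := S.characteristic_of_isMaximalConvexSequence hmax r i
    exact ⟨this, inferInstance⟩
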